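/- Let $\alpha>3$ and $2^{*}=\frac{2(\alpha+1)}{\alpha-3}$. For a function $u$ on $(0,\infty)$ put $\Delta_\alpha u=u''+\frac{\alpha}{r}u'$ and $\|f\|_{L^q_\alpha}=\big(\int_0^\infty|f(r)|^q r^\alpha\,dr\big)^{1/q}$. Let $\mathcal D=\mathcal D^{2,2}_\infty(\alpha)$ be the space of all functions $u$ on $(0,\infty)$ such that $u$ is differentiable, $u'$ is locally absolutely continuous, $u(r)\to0$ and $u'(r)\to 0$ as $r\to\infty$, and $u''\in L^2_\alpha$ (this space is complete under the norm $\|u''\|_{L^2_\alpha}$). Let $$\mathcal S=\mathcal S(2,2,\alpha,\alpha,\infty)=\inf\left\{\frac{\|\Delta_\alpha u\|_{L^2_\alpha}^2}{\|u\|_{L^{2^*}_\alpha}^2}\;:\;u\in\mathcal D\setminus\{0\}\right\}.$$ A minimizer for $\mathcal S$ is a $z\in\mathcal D\setminus\{0\}$ at which the infimum is attained. A function $u\in C^4(0,\infty)$ is called $\ell$-th nonsingular at $r=0$ if the finite limit $u^{(i)}(0):=\lim_{r\to0^+}u^{(i)}(r)$ exists for every $0\le i\le\ell$. 1. Suppose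 that $\mathcal S$ admits a $0$-th nonsingular minimizer. Then $\mathcal S^{-1/2}$ is the best (smallest) constant $C$ for which every $u\in\mathcal D$ satisfies $u\in L^{2^*}_\alpha$, $\Delta_\alpha u\in L^2_\alpha$ and $\|u\|_{L^{2^*}_\alpha}\le C\,\|\Delta_\alpha u\|_{L^2_\alpha}$, and $$\mathcal S^{-\frac12}=\mathcal P^{-\frac12}\left[\frac{2\,\Gamma(\alpha+1)}{\Gamma(\frac{\alpha+1}{2})\,\Gamma(\frac{\alpha+1}{2})}\right]^{\frac{2}{\alpha+1}},\qquad \mathcal P=\prod_{h=-2}^{1}(\alpha+1+2h)=(\alpha-3)(\alpha-1)(\alpha+1)(\alpha+3).$$ 2. Every $0$-th nonsingular minimizer $z$ for $\mathcal S$ is $3$rd nonsingular at $r=0$ and satisfies $z'(0)=z'''(0)=0$. 3. Let $u\in\mathcal D$ be a weak solution of $\Delta_\alpha^2u=|u|^{2^*-2}u$ in $(0,\infty)$, that is, $\int_0^\infty\Delta_\alpha u\,\Delta_\alpha v\,r^\alpha\,dr=\int_0^\infty|u|^{2^*-2}u\,v\,r^\alpha\,dr$ for all $v\in\mathcal D$.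 If $u>0$ on $(0,\infty)$ and $\lim_{r\to0^+}u(r)$ exists and is finite, then $u\in C^4(0,\infty)$, $u$ is $3$rd nonsingular at $r=0$, and $u'(0)=u'''(0)=0$. -/

import Mathlib

open MeasureTheory Set Filter Topology

namespace WeightedRadial

/-- The space `𝓓^{2,2}_∞(α)` for `α > 3`: functions `u` on `(0, ∞)` such that `u` is differentiable,
`u'` is locally absolutely continuous, `u(r) → 0` and `u'(r) → 0` as `r → ∞`, and
`∫₀^∞ |u''|² r^α dr < ∞`. Functions are total functions on `ℝ`, of which only the values on
`(0, ∞)` are used.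

The norm is `(∫₀^∞ |u''|² r^α dr)^{1/2}`. For `α > 3` the map `u ↦ u''` is a bijection onto the
weighted Lebesgue space `L²_α` (`exists_mem_space_deriv_deriv_eq` and
`eq_zero_of_deriv_deriv_eq_zero` below), so this normed space is already complete and coincides
with its completion. -/
def space (α : ℝ) : Set (ℝ → ℝ) :=
  {u | (∀ r, 0 < r → DifferentiableAt ℝ u r) ∧
    (∀ a b, 0 < a → a ≤ b → AbsolutelyContinuousOnInterval (deriv u) a b) ∧
    Tendsto u atTop (𝓝 0) ∧ Tendsto (deriv u) atTop (𝓝 0) ∧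
    IntegrableOn (fun r => (deriv (deriv u) r) ^ 2 * r ^ α) (Ioi 0)}

/-- The generalized radial Laplacian `Δ_α u = u'' + (α / r) u' = r^{-α} (r^α u')'`. -/
noncomputable def laplacian (α : ℝ) (u : ℝ → ℝ) (r : ℝ) : ℝ :=
  deriv (deriv u) r + α / r * deriv u r

/-- The norm of `L^q_α(0, ∞)`, `(∫₀^∞ |f(r)|^q r^α dr)^{1/q}`. -/
noncomputable def weightedNorm (α q : ℝ) (f : ℝ → ℝ) : ℝ :=
  (∫ r in Ioi (0 : ℝ), |f r| ^ q * r ^ α) ^ (1 / q)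

/-- The critical exponent `2* = 2 (α + 1) / (α - 2 m + 1)` for `m = 2`. -/
noncomputable def critExp (α : ℝ) : ℝ := 2 * (α + 1) / (α - 3)

/-- `u` does not vanish identically on `(0, ∞)`. -/
def Nontriv (u : ℝ → ℝ) : Prop := ∃ r, 0 < r ∧ u r ≠ 0

/-- The quotient `‖Δ_α u‖²_{L²_α} / ‖u‖²_{L^{2*}_α}`. -/
noncomputable def quotient (α : ℝ) (u : ℝ → ℝ) : ℝ :=
  weightedNorm α 2 (laplacian α u) ^ 2 / weightedNorm α (critExp α) u ^ 2

/-- `𝓢(2, 2, α, α, ∞)`, the infimum of the quotient over `𝓓^{2,2}_∞(α) \ {0}`. -/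
noncomputable def sobolevS (α : ℝ) : ℝ :=
  sInf {q : ℝ | ∃ u ∈ space α, Nontriv u ∧ q = quotient α u}

/-- `z` is a minimizer for `𝓢(2, 2, α, α, ∞)`. -/
def IsMinimizer (α : ℝ) (z : ℝ → ℝ) : Prop :=
  z ∈ space α ∧ Nontriv z ∧ quotient α z = sobolevS α

/-- `u ∈ C⁴(0, ∞)` is `ℓ`-th nonsingular at `r = 0`: `u^{(i)}` has a finite limit at `0⁺` for
every `0 ≤ i ≤ ℓ`. -/
def Nonsingular (l : ℕ) (u : ℝ → ℝ) : Prop :=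
  ContDiffOn ℝ 4 u (Ioi 0) ∧
    ∀ i ≤ l, ∃ c : ℝ, Tendsto (iteratedDeriv i u) (𝓝[>] 0) (𝓝 c)

/-- `u ∈ 𝓓^{2,2}_∞(α)` is a weak solution of `Δ_α² u = |u|^{2* - 2} u` in `(0, ∞)`. -/
def IsWeakSolution (α : ℝ) (u : ℝ → ℝ) : Prop :=
  u ∈ space α ∧ ∀ v ∈ space α,
    ∫ r in Ioi (0 : ℝ), laplacian α u r * laplacian α v r * r ^ α =
      ∫ r in Ioi (0 : ℝ), |u r| ^ (critExp α - 2) * u r * v r * r ^ α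

/-- `C` is an admissible constant in the embedding of `𝓓^{2,2}_∞(α)` into `L^{2*}_α`: every `u`
in the space satisfies `u ∈ L^{2*}_α`, `Δ_α u ∈ L²_α` and
`‖u‖_{L^{2*}_α} ≤ C ‖Δ_α u‖_{L²_α}`. -/
def IsEmbeddingConstant (α C : ℝ) : Prop :=
  ∀ u ∈ space α,
    IntegrableOn (fun r => |u r| ^ critExp α * r ^ α) (Ioi 0) ∧
    IntegrableOn (fun r => |laplacian α u r| ^ (2 : ℝ) * r ^ α) (Ioi 0) ∧
    weightedNorm α (critExp α) u ≤ C * weightedNorm α 2 (laplacian α u)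

/-- The constant `P(α, m) = ∏_{h = -m}^{m - 1} (α + 1 + 2 h)`. -/
noncomputable def constP (α : ℝ) (m : ℕ) : ℝ :=
  ∏ h ∈ Finset.Ico (-(m : ℤ)) (m : ℤ), (α + 1 + 2 * (h : ℝ))

/-- For `α > 3` every `g ∈ L²_α(0, ∞)` is the second derivative of some `u` in the space. -/
theorem exists_mem_space_deriv_deriv_eq {α : ℝ} (hα : 3 < α) {g : ℝ → ℝ}
    (hm : AEStronglyMeasurable g (volume.restrict (Ioi 0)))
    (hg : IntegrableOn (fun r => g r ^ 2 * r ^ α) (Ioi 0)) :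
    ∃ u ∈ space α, deriv (deriv u) =ᵐ[volume.restrict (Ioi 0)] g := by
  -- a bound for the tail integrals of `|g|`
  set K : ℝ := ∫ r in Ioi (0 : ℝ), g r ^ 2 * r ^ α with hK
  have hK0 : 0 ≤ K := setIntegral_nonneg measurableSet_Ioi fun r hr => by
    have : (0 : ℝ) < r := hr
    positivity
  have hsub : ∀ a : ℝ, 0 < a → volume.restrict (Ioi a) ≤ volume.restrict (Ioi (0 : ℝ)) :=
    fun a ha => Measure.restrict_mono (Ioi_subset_Ioi ha.le) le_rfl
  have hpt : ∀ t r : ℝ, 0 < t → 0 < r → |g r| ≤ t * (g r ^ 2 * r ^ α) + t⁻¹ * r ^ (-α) := by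
    intro t r ht hr
    have h1 : 0 < r ^ α := Real.rpow_pos_of_pos hr α
    rw [Real.rpow_neg hr.le]
    set w := r ^ α
    have h2 : t * (g r ^ 2 * w) + t⁻¹ * w⁻¹ - |g r| =
        ((t * w * |g r| - 1 / 2) ^ 2 + 3 / 4) / (t * w) := by
      rw [← sq_abs (g r)]
      field_simp
      ring
    have h3 : 0 ≤ t * (g r ^ 2 * w) + t⁻¹ * w⁻¹ - |g r| := by
      rw [h2]; positivity
    linarith
  have hrp : ∀ a : ℝ, 0 < a → IntegrableOn (fun r : ℝ => r ^ (-α)) (Ioi a) := fun a ha =>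
    integrableOn_Ioi_rpow_of_lt (by linarith) ha
  have hgi : ∀ a : ℝ, 0 < a → IntegrableOn g (Ioi a) := by
    intro a ha
    refine Integrable.mono' ((hg.mono_set (Ioi_subset_Ioi ha.le)).add (hrp a ha))
      (hm.mono_measure (hsub a ha)) ?_
    filter_upwards [ae_restrict_mem measurableSet_Ioi] with r hr
    have := hpt 1 r one_pos (ha.trans hr)
    simpa using this
  have htail : ∀ a : ℝ, 0 < a → |∫ r in Ioi a, g r| ≤ (K + 1) * a ^ (-((α - 1) / 2)) := by
    intro a ha
    set t := a ^ (-((α - 1) / 2)) with ht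
    have ht0 : 0 < t := Real.rpow_pos_of_pos ha _
    have htt : t * t = a ^ (-α + 1) := by
      rw [ht, ← Real.rpow_add ha]; congr 1; ring
    have hgK := hg.mono_set (Ioi_subset_Ioi ha.le)
    calc |∫ r in Ioi a, g r| ≤ ∫ r in Ioi a, |g r| := abs_integral_le_integral_abs
      _ ≤ ∫ r in Ioi a, (t * (g r ^ 2 * r ^ α) + t⁻¹ * r ^ (-α)) := by
          refine setIntegral_mono_on (hgi a ha).abs
            ((hgK.const_mul t).add ((hrp a ha).const_mul t⁻¹)) measurableSet_Ioi ?_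
          exact fun r hr => hpt t r ht0 (ha.trans hr)
      _ = t * (∫ r in Ioi a, g r ^ 2 * r ^ α) + t⁻¹ * ∫ r in Ioi a, r ^ (-α) := by
          rw [integral_add (hgK.const_mul t) ((hrp a ha).const_mul t⁻¹), integral_const_mul,
            integral_const_mul]
      _ ≤ t * K + t := by
          gcongr
          · refine setIntegral_mono_set hg ?_ (Ioi_subset_Ioi ha.le).eventuallyLE
            filter_upwards [ae_restrict_mem measurableSet_Ioi] with r hr
            have : (0 : ℝ) < r := hr
            simp only [Pi.zero_apply]
            positivity
          · rw [integral_Ioi_rpow_of_lt (by linarith) ha, ← htt,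
              show -(t * t) / (-α + 1) = t * (t / (α - 1)) by
                rw [show -α + 1 = -(α - 1) by ring, neg_div_neg_eq]; ring,
              inv_mul_cancel_left₀ ht0.ne']
            exact div_le_self ht0.le (by linarith)
      _ = (K + 1) * t := by ring
  -- the first primitive
  set G : ℝ → ℝ := fun r => - ∫ s in Ioi r, g s with hG
  have hgint : ∀ a b : ℝ, 0 < a → a ≤ b → IntervalIntegrable g volume a b := fun a b ha hab =>
    (intervalIntegrable_iff_integrableOn_Ioc_of_le hab).2
      ((hgi a ha).mono_set Ioc_subset_Ioi_self)
  have hGeq : ∀ a r : ℝ, 0 < a → 0 < r → G r = G a + ∫ s in a..r, g s := by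
    intro a r ha hr
    have := intervalIntegral.integral_interval_add_Ioi' (a := a) (b := r) (f := g) (μ := volume)
      (by
        rcases le_total a r with h | h
        · exact hgint a r ha h
        · exact (hgint r a hr h).symm) (hgi r hr)
    simp only [hG]
    linarith
  have hGac : ∀ a b : ℝ, 0 < a → a ≤ b → AbsolutelyContinuousOnInterval G a b := by
    intro a b ha hab
    have h1 := (hgint a b ha hab).absolutelyContinuousOnInterval_intervalIntegral
      (c := a) (by simp)
    rw [absolutelyContinuousOnInterval_iff] at h1 ⊢
    intro ε hε
    obtain ⟨δ, hδ, h⟩ := h1 ε hε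
    refine ⟨δ, hδ, fun E hE hEs => ?_⟩
    refine lt_of_eq_of_lt (Finset.sum_congr rfl fun i hi => ?_) (h E hE hEs)
    have hE' := hE.1 i hi
    rw [uIcc_of_le hab] at hE'
    rw [hGeq a _ ha (ha.trans_le hE'.1.1), hGeq a _ ha (ha.trans_le hE'.2.1), dist_add_left]
  have hGc : ContinuousOn G (Ioi 0) := by
    intro r hr
    have hr' : (0 : ℝ) < r := hr
    have h1 := (hGac (r / 2) (2 * r) (by linarith) (by linarith)).continuousOn
    rw [uIcc_of_le (by linarith)] at h1
    exact (h1.continuousAt (Icc_mem_nhds (by linarith) (by linarith))).continuousWithinAt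
  have hGb : ∀ a : ℝ, 0 < a → |G a| ≤ (K + 1) * a ^ (-((α - 1) / 2)) := fun a ha => by
    simp only [hG, abs_neg]; exact htail a ha
  have hGi : ∀ a : ℝ, 0 < a → IntegrableOn G (Ioi a) := by
    intro a ha
    have h1 : IntegrableOn (fun r : ℝ => (K + 1) * r ^ (-((α - 1) / 2))) (Ioi a) :=
      (integrableOn_Ioi_rpow_of_lt (by linarith) ha).const_mul _
    refine Integrable.mono' h1
      ((hGc.mono (Ioi_subset_Ioi ha.le)).aestronglyMeasurable measurableSet_Ioi) ?_
    filter_upwards [ae_restrict_mem measurableSet_Ioi] with r hr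
    exact hGb r (ha.trans hr)
  -- the second primitive
  set u : ℝ → ℝ := fun r => - ∫ s in Ioi r, G s with hu
  have hGint : ∀ a r : ℝ, 0 < a → 0 < r → IntervalIntegrable G volume a r := by
    intro a r ha hr
    refine (hGc.mono ?_).intervalIntegrable
    intro x hx
    exact (lt_min ha hr).trans_le hx.1
  have hueq : ∀ a r : ℝ, 0 < a → 0 < r → u r = u a + ∫ s in a..r, G s := by
    intro a r ha hr
    have := intervalIntegral.integral_interval_add_Ioi' (a := a) (b := r) (f := G) (μ := volume)
      (hGint a r ha hr) (hGi r hr)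
    simp only [hu]
    linarith
  have hud : ∀ r : ℝ, 0 < r → HasDerivAt u (G r) r := by
    intro r hr
    have hcr : ContinuousAt G r := hGc.continuousAt (Ioi_mem_nhds hr)
    have h1 : HasDerivAt (fun x => u 1 + ∫ s in (1 : ℝ)..x, G s) (G r) r := by
      refine (intervalIntegral.integral_hasDerivAt_right (hGint 1 r one_pos hr) ?_ hcr).const_add _
      exact hGc.stronglyMeasurableAtFilter isOpen_Ioi r hr
    refine h1.congr_of_eventuallyEq ?_
    filter_upwards [Ioi_mem_nhds hr] with x hx
    exact hueq 1 x one_pos hx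
  have hdu : ∀ r : ℝ, 0 < r → deriv u r = G r := fun r hr => (hud r hr).deriv
  have hlim : ∀ f : ℝ → ℝ, IntegrableOn f (Ioi 1) →
      Tendsto (fun r => - ∫ s in Ioi r, f s) atTop (𝓝 0) := by
    intro f hf
    have h1 := (intervalIntegral_tendsto_integral_Ioi 1 hf tendsto_id).sub_const
      (∫ s in Ioi 1, f s)
    rw [sub_self] at h1
    refine h1.congr' ?_
    filter_upwards [eventually_ge_atTop 1] with r hr
    have h2 := intervalIntegral.integral_Ioi_sub_Ioi hf hr
    simp only [id]
    linarith
  have hddu : deriv (deriv u) =ᵐ[volume.restrict (Ioi 0)] g := by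
    have hev : ∀ r : ℝ, 0 < r → deriv u =ᶠ[𝓝 r] G := fun r hr => by
      filter_upwards [Ioi_mem_nhds hr] with x hx using hdu x hx
    have hn : ∀ n : ℕ, ∀ᵐ x, x ∈ uIcc (1 / ((n : ℝ) + 1)) ((n : ℝ) + 1) →
        deriv (deriv u) x = g x := by
      intro n
      have hn0 : (0 : ℝ) < 1 / ((n : ℝ) + 1) := by positivity
      have hle : 1 / ((n : ℝ) + 1) ≤ (n : ℝ) + 1 := by
        have : (1 : ℝ) ≤ (n : ℝ) + 1 := by linarith [n.cast_nonneg (α := ℝ)]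
        exact (div_le_one (by linarith)).2 this |>.trans this
      filter_upwards [(hgint _ _ hn0 hle).ae_hasDerivAt_integral] with x hx hxm
      have h1 := hx hxm (1 / ((n : ℝ) + 1)) left_mem_uIcc
      rw [uIcc_of_le hle] at hxm
      have hx0 : 0 < x := hn0.trans_le hxm.1
      have h2 : HasDerivAt G (g x) x := by
        refine (h1.const_add (G (1 / ((n : ℝ) + 1)))).congr_of_eventuallyEq ?_
        filter_upwards [Ioi_mem_nhds hx0] with y hy
        exact hGeq _ y hn0 hy
      rw [(hev x hx0).deriv_eq, h2.deriv]
    filter_upwards [ae_restrict_of_ae (ae_all_iff.2 hn), ae_restrict_mem measurableSet_Ioi]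
      with x hx hx0
    have hx0' : (0 : ℝ) < x := hx0
    obtain ⟨n, hn⟩ := exists_nat_gt (max x x⁻¹)
    have h1 : x < n := (le_max_left _ _).trans_lt hn
    have h2 : x⁻¹ < n := (le_max_right _ _).trans_lt hn
    refine hx n (Icc_subset_uIcc ⟨?_, by linarith⟩)
    rw [one_div]
    exact inv_le_of_inv_le₀ hx0' (by linarith)
  refine ⟨u, ⟨fun r hr => (hud r hr).differentiableAt, ?_, hlim G (hGi 1 one_pos), ?_, ?_⟩, hddu⟩
  · intro a b ha hab
    have h1 := hGac a b ha hab
    rw [absolutelyContinuousOnInterval_iff] at h1 ⊢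
    intro ε hε
    obtain ⟨δ, hδ, h⟩ := h1 ε hε
    refine ⟨δ, hδ, fun E hE hEs => ?_⟩
    refine lt_of_eq_of_lt (Finset.sum_congr rfl fun i hi => ?_) (h E hE hEs)
    have hE' := hE.1 i hi
    rw [uIcc_of_le hab] at hE'
    rw [hdu _ (ha.trans_le hE'.1.1), hdu _ (ha.trans_le hE'.2.1)]
  · refine (hlim g (hgi 1 one_pos)).congr' ?_
    filter_upwards [eventually_gt_atTop 0] with r hr
    rw [hdu r hr]
  · refine hg.congr ?_
    filter_upwards [hddu] with r hr
    rw [hr]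

/-- An element of the space with `u'' = 0` almost everywhere vanishes on `(0, ∞)`. -/
theorem eq_zero_of_deriv_deriv_eq_zero {α : ℝ} {u : ℝ → ℝ} (hu : u ∈ space α)
    (h : deriv (deriv u) =ᵐ[volume.restrict (Ioi 0)] 0) : ∀ r, 0 < r → u r = 0 := by
  obtain ⟨hd, hac, h0, h1, -⟩ := hu
  have hd0 : ∀ r, 0 < r → deriv u r = 0 := by
    intro a ha
    refine tendsto_nhds_unique (tendsto_const_nhds.congr' ?_) h1
    filter_upwards [eventually_ge_atTop a] with b hab
    have h2 := (hac a b ha hab).integral_deriv_eq_sub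
    rw [intervalIntegral.integral_of_le hab, integral_eq_zero_of_ae
      (ae_restrict_of_ae_restrict_of_subset (fun x hx => ha.trans hx.1) h)] at h2
    linarith
  intro a ha
  refine tendsto_nhds_unique (tendsto_const_nhds.congr' ?_) h0
  filter_upwards [eventually_ge_atTop a] with b hab
  refine (constant_of_derivWithin_zero (a := a) (b := b) (f := u) ?_ ?_ b
    (right_mem_Icc.2 hab)).symm
  · exact fun x hx => (hd x (ha.trans_le hx.1)).differentiableWithinAt
  · intro x hx
    have hx0 := ha.trans_le hx.1
    rw [(hd x hx0).derivWithin (uniqueDiffOn_Icc (hx.1.trans_lt hx.2) x ⟨hx.1, hx.2.le⟩)]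
    exact hd0 x hx0

end WeightedRadial

/-!
The proof replaces the theory of extremals for higher-order Sobolev inequalities by explicit
one-dimensional computations. Write `p = 2*` and consider a weak solution of `Δ_α² u = κ |u|^{p-2}
u` with a finite limit at the origin.

*Regularity.* The space contains the explicit function `ballPotential α b`, whose `Δ_α` is the
indicator function of `(0, b)`. Since `∫₀^b Δ_α u r^α dr = b^α u'(b)`, testing the weak equation
with it expresses `u'(b)`, for every `b > 0`, by integrals of the right-hand side `f`
(`deriv_eq_greenDeriv1`). As `f` is continuous up to the origin, this formula can be
differentiated three times, and the limits at the origin can be read off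
(`nonsingular_three_of_weak`). A minimizer is such a weak solution
by the Euler-Lagrange equation (`IsMinimizer.weak`).

*Classification.* The equation is a system for `u`, `r^α u'`, `w = Δ_α u`, `r^α w'` with regular
data at the origin (`RadialSystem`). If two solutions have the same value at the origin and
different values of `Δ_α u` there, then their difference is monotone on all of `(0, ∞)`, because
the nonlinearity is increasing, so they do not both decay (`RadialSystem.not_tendsto_zero`); if
the values of `Δ_α u` also agree, the solutions coincide by Grönwall's inequality
(`RadialSystem.eq_zero`). Hence a decaying solution is determined by `c = u(0)`. For each `c`, a
function `c (1 + μ r²)^{-(α-3)/2}` is a solution with that value, so there are no others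
(`eq_profile_of_weak`).

*The constant.* For a minimizer `z` with `J = ∫ |z|^p r^α dr` the multiplier is `κ = 𝓢 J^{2/p-1}`,
while the classification gives `P μ² = κ |c|^{p-2}` and reduces `J` to a Beta integral
(`Gamma_mul_integral_profile`). Eliminating `κ`, `c` and `μ` leaves `𝓢` (`sobolevS_eq`). The
embedding itself follows from Hardy's inequality and the pointwise decay of the elements of the
space (`integrableOn_abs_rpow_critExp`).
-/

namespace WeightedRadial

/-! ### Decay and Hardy's inequality for absolutely continuous functions -/

/-- Integrability on `(0, ∞)` from a uniform bound for the integrals over compact intervals. -/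
theorem integrableOn_Ioi_of_intervalIntegral_le {f : ℝ → ℝ} (I : ℝ) (hf : ∀ r, 0 < r → 0 ≤ f r)
    (hi : ∀ a b, 0 < a → a ≤ b → IntervalIntegrable f volume a b)
    (hI : ∀ a b, 0 < a → a ≤ b → ∫ r in a..b, f r ≤ I) : IntegrableOn f (Ioi 0) := by
  have ha : Tendsto (fun n : ℕ => 1 / ((n : ℝ) + 1)) atTop (𝓝 0) :=
    tendsto_one_div_add_atTop_nhds_zero_nat
  have hb : Tendsto (fun n : ℕ => (n : ℝ) + 1) atTop atTop :=
    tendsto_atTop_add_const_right _ _ tendsto_natCast_atTop_atTop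
  have hcov : AECover (volume.restrict (Ioi (0 : ℝ))) atTop
      (fun n : ℕ => Ioi (1 / ((n : ℝ) + 1)) ∩ Iic ((n : ℝ) + 1)) :=
    (aecover_Ioi_of_Ioi ha).inter ((aecover_Iic hb).restrict)
  have h0 : ∀ n : ℕ, (0 : ℝ) < 1 / ((n : ℝ) + 1) := fun n => by positivity
  have hle : ∀ n : ℕ, 1 / ((n : ℝ) + 1) ≤ (n : ℝ) + 1 := fun n => by
    have : (1 : ℝ) ≤ (n : ℝ) + 1 := by linarith [n.cast_nonneg (α := ℝ)]
    exact ((div_le_one (by linarith)).2 this).trans this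
  have hres : ∀ n : ℕ, (volume.restrict (Ioi (0 : ℝ))).restrict
      (Ioi (1 / ((n : ℝ) + 1)) ∩ Iic ((n : ℝ) + 1)) =
      volume.restrict (Ioc (1 / ((n : ℝ) + 1)) ((n : ℝ) + 1)) := fun n => by
    rw [Ioi_inter_Iic, Measure.restrict_restrict measurableSet_Ioc, inter_eq_left.2]
    exact fun x hx => (h0 n).trans hx.1
  refine hcov.integrable_of_integral_norm_bounded I (fun n => ?_) (Eventually.of_forall fun n => ?_)
  · rw [IntegrableOn, hres]
    exact (intervalIntegrable_iff_integrableOn_Ioc_of_le (hle n)).1 (hi _ _ (h0 n) (hle n))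
  · rw [hres]
    refine le_trans (le_of_eq ?_) (hI _ _ (h0 n) (hle n))
    rw [intervalIntegral.integral_of_le (hle n)]
    refine setIntegral_congr_fun measurableSet_Ioc fun x hx => ?_
    exact Real.norm_of_nonneg (hf x ((h0 n).trans hx.1))

theorem absolutelyContinuousOnInterval_of_hasDerivAt {f f' : ℝ → ℝ}
    (hf : ∀ r, 0 < r → HasDerivAt f (f' r) r) (hc : ContinuousOn f' (Ioi 0)) {a b : ℝ}
    (ha : 0 < a) (hab : a ≤ b) : AbsolutelyContinuousOnInterval f a b := by
  obtain ⟨C, hC⟩ := (isCompact_Icc (a := a) (b := b)).exists_bound_of_continuousOn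
    (hc.mono fun x hx => ha.trans_le hx.1)
  refine LipschitzOnWith.absolutelyContinuousOnInterval (K := C.toNNReal) ?_
  rw [uIcc_of_le hab]
  refine (convex_Icc a b).lipschitzOnWith_of_nnnorm_hasDerivWithin_le (f' := f')
    (fun x hx => (hf x (ha.trans_le hx.1)).hasDerivWithinAt) fun x hx => ?_
  rw [← NNReal.coe_le_coe, coe_nnnorm]
  exact (hC x hx).trans (Real.le_coe_toNNReal C)

theorem continuousOn_of_absolutelyContinuousOnInterval {h : ℝ → ℝ}
    (hac : ∀ a b, 0 < a → a ≤ b → AbsolutelyContinuousOnInterval h a b) :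
    ContinuousOn h (Ioi 0) := by
  intro r hr
  have hr' : (0 : ℝ) < r := hr
  have h1 := (hac (r / 2) (2 * r) (by linarith) (by linarith)).continuousOn
  rw [uIcc_of_le (by linarith)] at h1
  exact (h1.continuousAt (Icc_mem_nhds (by linarith) (by linarith))).continuousWithinAt

theorem ae_differentiableAt_of_absolutelyContinuousOnInterval {h : ℝ → ℝ}
    (hac : ∀ a b, 0 < a → a ≤ b → AbsolutelyContinuousOnInterval h a b) :
    ∀ᵐ r ∂(volume.restrict (Ioi (0 : ℝ))), DifferentiableAt ℝ h r := by
  have hle : ∀ n : ℕ, 1 / ((n : ℝ) + 1) ≤ (n : ℝ) + 1 := fun n => by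
    have : (1 : ℝ) ≤ (n : ℝ) + 1 := by linarith [n.cast_nonneg (α := ℝ)]
    exact ((div_le_one (by linarith)).2 this).trans this
  have hn : ∀ n : ℕ, ∀ᵐ x, x ∈ uIcc (1 / ((n : ℝ) + 1)) ((n : ℝ) + 1) → DifferentiableAt ℝ h x :=
    fun n => (hac _ _ (by positivity) (hle n)).ae_differentiableAt
  filter_upwards [ae_restrict_of_ae (ae_all_iff.2 hn), ae_restrict_mem measurableSet_Ioi]
    with x hx hx0
  have hx0' : (0 : ℝ) < x := hx0
  obtain ⟨n, hn⟩ := exists_nat_gt (max x x⁻¹)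
  have h1 : x < n := (le_max_left _ _).trans_lt hn
  have h2 : x⁻¹ < n := (le_max_right _ _).trans_lt hn
  refine hx n (Icc_subset_uIcc ⟨?_, by linarith⟩)
  rw [one_div]
  exact inv_le_of_inv_le₀ hx0' (by linarith)

/-- The pointwise decay of a function with `h' ∈ L²(r^β dr)` and `h → 0` at infinity, by the
Cauchy-Schwarz inequality for `h(r) = -∫_r^∞ h'`. -/
theorem exists_abs_le_rpow_of_deriv_sq_integrable {β : ℝ} (hβ : 1 < β) {h : ℝ → ℝ}
    (hac : ∀ a b, 0 < a → a ≤ b → AbsolutelyContinuousOnInterval h a b)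
    (h0 : Tendsto h atTop (𝓝 0))
    (hi : IntegrableOn (fun r => deriv h r ^ 2 * r ^ β) (Ioi 0)) :
    ∃ K, 0 ≤ K ∧ ∀ r, 0 < r → |h r| ≤ K * r ^ (-((β - 1) / 2)) := by
  set I : ℝ := ∫ r in Ioi (0 : ℝ), deriv h r ^ 2 * r ^ β with hI
  have hnn : ∀ r : ℝ, 0 < r → 0 ≤ deriv h r ^ 2 * r ^ β := fun r hr => by positivity
  have hI0 : 0 ≤ I := setIntegral_nonneg measurableSet_Ioi hnn
  have hb0 : 0 < β - 1 := by linarith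
  refine ⟨I + 1 / (β - 1), by positivity, fun r hr => ?_⟩
  -- the weight `t` balances the two terms of Young's inequality on `(r, ∞)`
  set t := r ^ (-((β - 1) / 2)) with ht
  have ht0 : 0 < t := Real.rpow_pos_of_pos hr _
  have htt : t * t = r ^ (-β + 1) := by
    rw [ht, ← Real.rpow_add hr]; congr 1; ring
  have hpt : ∀ s : ℝ, 0 < s →
      |deriv h s| ≤ t * (deriv h s ^ 2 * s ^ β) + t⁻¹ * s ^ (-β) := by
    intro s hs
    have h1 : 0 < s ^ β := Real.rpow_pos_of_pos hs β
    rw [Real.rpow_neg hs.le]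
    set w := s ^ β
    have h2 : t * (deriv h s ^ 2 * w) + t⁻¹ * w⁻¹ - |deriv h s| =
        ((t * w * |deriv h s| - 1 / 2) ^ 2 + 3 / 4) / (t * w) := by
      rw [← sq_abs (deriv h s)]
      field_simp
      ring
    have h3 : 0 ≤ t * (deriv h s ^ 2 * w) + t⁻¹ * w⁻¹ - |deriv h s| := by
      rw [h2]; positivity
    linarith
  have hrp : IntegrableOn (fun s : ℝ => s ^ (-β)) (Ioi r) :=
    integrableOn_Ioi_rpow_of_lt (by linarith) hr
  have hir := hi.mono_set (Ioi_subset_Ioi hr.le)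
  have hbound : ∀ b, r ≤ b → |h r| - |h b| ≤ (I + 1 / (β - 1)) * t := by
    intro b hb
    have e1 := (hac r b hr hb).integral_deriv_eq_sub
    have hInt := (hac r b hr hb).intervalIntegrable_deriv
    calc |h r| - |h b| ≤ |h b - h r| := by rw [abs_sub_comm]; exact abs_sub_abs_le_abs_sub _ _
      _ ≤ ∫ s in Ioc r b, |deriv h s| := by
          rw [← e1, intervalIntegral.integral_of_le hb]; exact abs_integral_le_integral_abs
      _ ≤ ∫ s in Ioc r b, (t * (deriv h s ^ 2 * s ^ β) + t⁻¹ * s ^ (-β)) := by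
          refine setIntegral_mono_on
            ((intervalIntegrable_iff_integrableOn_Ioc_of_le hb).1 hInt).abs
            (IntegrableOn.mono_set ((hir.const_mul t).add (hrp.const_mul t⁻¹)) Ioc_subset_Ioi_self)
            measurableSet_Ioc fun s hs => hpt s (hr.trans hs.1)
      _ ≤ ∫ s in Ioi r, (t * (deriv h s ^ 2 * s ^ β) + t⁻¹ * s ^ (-β)) := by
          refine setIntegral_mono_set ((hir.const_mul t).add (hrp.const_mul t⁻¹)) ?_
            Ioc_subset_Ioi_self.eventuallyLE
          filter_upwards [ae_restrict_mem measurableSet_Ioi] with s hs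
          have : (0 : ℝ) < s := hr.trans hs
          simp only [Pi.zero_apply]
          positivity
      _ = t * (∫ s in Ioi r, deriv h s ^ 2 * s ^ β) + t⁻¹ * ∫ s in Ioi r, s ^ (-β) := by
          rw [integral_add (hir.const_mul t) (hrp.const_mul t⁻¹), integral_const_mul,
            integral_const_mul]
      _ ≤ t * I + t / (β - 1) := by
          refine add_le_add (mul_le_mul_of_nonneg_left ?_ ht0.le) (le_of_eq ?_)
          · refine setIntegral_mono_set hi ?_ (Ioi_subset_Ioi hr.le).eventuallyLE
            filter_upwards [ae_restrict_mem measurableSet_Ioi] with s hs using hnn s hs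
          · rw [integral_Ioi_rpow_of_lt (by linarith) hr, ← htt,
              show -(t * t) / (-β + 1) = t * (t / (β - 1)) by
                rw [show -β + 1 = -(β - 1) by ring, neg_div_neg_eq]; ring,
              inv_mul_cancel_left₀ ht0.ne']
      _ = (I + 1 / (β - 1)) * t := by ring
  have hlim : Tendsto (fun b => |h r| - |h b|) atTop (𝓝 (|h r| - |(0 : ℝ)|)) :=
    h0.abs.const_sub _
  rw [abs_zero, sub_zero] at hlim
  refine le_of_tendsto hlim ?_
  filter_upwards [eventually_ge_atTop r] with b hb using hbound b hb

/-- Hardy's inequality, in the qualitative form `h' ∈ L²(r^β dr) ⟹ h ∈ L²(r^{β-2} dr)`. -/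
theorem integrableOn_sq_mul_rpow_sub_two {β : ℝ} (hβ : 1 < β) {h : ℝ → ℝ}
    (hac : ∀ a b, 0 < a → a ≤ b → AbsolutelyContinuousOnInterval h a b)
    (h0 : Tendsto h atTop (𝓝 0))
    (hi : IntegrableOn (fun r => deriv h r ^ 2 * r ^ β) (Ioi 0)) :
    IntegrableOn (fun r => h r ^ 2 * r ^ (β - 2)) (Ioi 0) := by
  obtain ⟨K, hK0, hK⟩ := exists_abs_le_rpow_of_deriv_sq_integrable hβ hac h0 hi
  set I : ℝ := ∫ r in Ioi (0 : ℝ), deriv h r ^ 2 * r ^ β with hI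
  have hb0 : 0 < β - 1 := by linarith
  have hcont := continuousOn_of_absolutelyContinuousOnInterval hac
  have hrc : ∀ γ : ℝ, ContinuousOn (fun r : ℝ => r ^ γ) (Ioi 0) := fun γ =>
    continuousOn_id.rpow_const fun x hx => Or.inl (ne_of_gt hx)
  have hint : ∀ a b, 0 < a → a ≤ b →
      IntervalIntegrable (fun r => h r ^ 2 * r ^ (β - 2)) volume a b := by
    intro a b ha hab
    refine (((hcont.pow 2).mul (hrc _)).mono fun x hx => ?_).intervalIntegrable
    rw [uIcc_of_le hab] at hx
    exact ha.trans_le hx.1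
  have hFK : ∀ r, 0 < r → h r ^ 2 * r ^ (β - 1) ≤ K ^ 2 := by
    intro r hr
    have h1 : h r ^ 2 ≤ (K * r ^ (-((β - 1) / 2))) ^ 2 := by
      rw [← sq_abs]
      exact pow_le_pow_left₀ (abs_nonneg _) (hK r hr) 2
    calc h r ^ 2 * r ^ (β - 1) ≤ (K * r ^ (-((β - 1) / 2))) ^ 2 * r ^ (β - 1) := by
          gcongr
      _ = K ^ 2 * (r ^ (-((β - 1) / 2)) * r ^ (-((β - 1) / 2)) * r ^ (β - 1)) := by ring
      _ = K ^ 2 := by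
          rw [← Real.rpow_add hr, ← Real.rpow_add hr]
          ring_nf
          simp
  refine integrableOn_Ioi_of_intervalIntegral_le
    (2 / (β - 1) * (K ^ 2 + 2 / (β - 1) * I)) (fun r hr => by positivity) hint ?_
  intro a b ha hab
  have hgac : AbsolutelyContinuousOnInterval (fun r : ℝ => r ^ (β - 1)) a b :=
    absolutelyContinuousOnInterval_of_hasDerivAt
      (f' := fun r => (β - 1) * r ^ (β - 1 - 1))
      (fun r hr => Real.hasDerivAt_rpow_const (Or.inl hr.ne'))
      (continuousOn_const.mul (hrc _)) ha hab
  -- compare the derivative of `h² r^{β-1}`, whose integral is bounded, with `h² r^{β-2}`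
  have hFac := ((hac a b ha hab).fun_mul (hac a b ha hab)).fun_mul hgac
  have e1 := hFac.integral_deriv_eq_sub
  have hi2 : IntervalIntegrable (fun r => deriv h r ^ 2 * r ^ β) volume a b :=
    (intervalIntegrable_iff_integrableOn_Ioc_of_le hab).2
      (hi.mono_set fun x hx => ha.trans hx.1)
  have hle : ∫ r in a..b, ((β - 1) / 2 * (h r ^ 2 * r ^ (β - 2)) -
      2 / (β - 1) * (deriv h r ^ 2 * r ^ β)) ≤
      ∫ r in a..b, deriv (fun x => h x * h x * x ^ (β - 1)) r := by
    refine intervalIntegral.integral_mono_ae_restrict hab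
      (((hint a b ha hab).const_mul _).sub (hi2.const_mul _)) hFac.intervalIntegrable_deriv ?_
    have hd := ae_differentiableAt_of_absolutelyContinuousOnInterval hac
    have hd' := ae_restrict_of_ae_restrict_of_subset
      (fun x (hx : x ∈ Icc a b) => (ha.trans_le hx.1 : x ∈ Ioi 0)) hd
    filter_upwards [hd', ae_restrict_mem measurableSet_Icc] with r hr hrm
    have hr0 : 0 < r := ha.trans_le hrm.1
    have hD := (hr.hasDerivAt.fun_mul hr.hasDerivAt).fun_mul
      (Real.hasDerivAt_rpow_const (p := β - 1) (Or.inl hr0.ne'))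
    rw [hD.deriv]
    have e2 : r ^ (β - 1 - 1) = r ^ (β - 2) := by congr 1; ring
    have e3 : r ^ (β - 1) = r ^ (β - 2) * r := by
      rw [← Real.rpow_add_one hr0.ne']; congr 1; ring
    have e4 : r ^ β = r ^ (β - 2) * r * r := by
      rw [← Real.rpow_add_one hr0.ne', ← Real.rpow_add_one hr0.ne']; congr 1; ring
    rw [e2, e3, e4]
    have hp : 0 ≤ r ^ (β - 2) := Real.rpow_nonneg hr0.le _
    set w := r ^ (β - 2)
    set d := deriv h r
    -- the cross term `2 h h' r^{β-1}` is absorbed by completing the square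
    have : (d * h r + h r * d) * (w * r) + h r * h r * ((β - 1) * w) -
        ((β - 1) / 2 * (h r ^ 2 * w) - 2 / (β - 1) * (d ^ 2 * (w * r * r))) =
        w * (((β - 1) * h r + 2 * d * r) ^ 2 / (2 * (β - 1))) := by
      field_simp
      ring
    have h2 : 0 ≤ w * (((β - 1) * h r + 2 * d * r) ^ 2 / (2 * (β - 1))) := by positivity
    linarith
  rw [e1, intervalIntegral.integral_sub ((hint a b ha hab).const_mul _) (hi2.const_mul _),
    intervalIntegral.integral_const_mul, intervalIntegral.integral_const_mul] at hle
  have h2 : ∫ r in a..b, deriv h r ^ 2 * r ^ β ≤ I := by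
    rw [intervalIntegral.integral_of_le hab]
    refine setIntegral_mono_set hi ?_
      (LE.le.eventuallyLE fun x (hx : x ∈ Ioc a b) => (ha.trans hx.1 : x ∈ Ioi 0))
    filter_upwards [ae_restrict_mem measurableSet_Ioi] with s hs
    have : (0 : ℝ) < s := hs
    simp only [Pi.zero_apply]
    positivity
  have h3 := hFK b (ha.trans_le hab)
  have h4 : 0 ≤ h a * h a * a ^ (β - 1) := mul_nonneg (mul_self_nonneg _) (by positivity)
  have h5 : (β - 1) / 2 * ∫ r in a..b, h r ^ 2 * r ^ (β - 2) ≤ K ^ 2 + 2 / (β - 1) * I := by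
    have : 2 / (β - 1) * ∫ r in a..b, deriv h r ^ 2 * r ^ β ≤ 2 / (β - 1) * I := by gcongr
    have e : h b * h b * b ^ (β - 1) = h b ^ 2 * b ^ (β - 1) := by ring
    linarith
  calc ∫ r in a..b, h r ^ 2 * r ^ (β - 2)
      = 2 / (β - 1) * ((β - 1) / 2 * ∫ r in a..b, h r ^ 2 * r ^ (β - 2)) := by
        field_simp
    _ ≤ _ := by gcongr

/-! ### Elements of the space and the embedding -/

theorem continuousOn_of_mem_space {α : ℝ} {u : ℝ → ℝ} (hu : u ∈ space α) :
    ContinuousOn u (Ioi 0) :=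
  fun r hr => (hu.1 r hr).continuousAt.continuousWithinAt

theorem continuousOn_deriv_of_mem_space {α : ℝ} {u : ℝ → ℝ} (hu : u ∈ space α) :
    ContinuousOn (deriv u) (Ioi 0) :=
  continuousOn_of_absolutelyContinuousOnInterval hu.2.1

theorem continuousOn_rpow_Ioi (γ : ℝ) : ContinuousOn (fun r : ℝ => r ^ γ) (Ioi 0) :=
  continuousOn_id.rpow_const fun _ hx => Or.inl (ne_of_gt hx)

theorem exists_abs_deriv_le_rpow {α : ℝ} (hα : 3 < α) {u : ℝ → ℝ} (hu : u ∈ space α) :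
    ∃ K, 0 ≤ K ∧ ∀ r, 0 < r → |deriv u r| ≤ K * r ^ (-((α - 1) / 2)) :=
  exists_abs_le_rpow_of_deriv_sq_integrable (by linarith) hu.2.1 hu.2.2.2.1 hu.2.2.2.2

theorem integrableOn_deriv_sq {α : ℝ} (hα : 3 < α) {u : ℝ → ℝ} (hu : u ∈ space α) :
    IntegrableOn (fun r => deriv u r ^ 2 * r ^ (α - 2)) (Ioi 0) :=
  integrableOn_sq_mul_rpow_sub_two (by linarith) hu.2.1 hu.2.2.2.1 hu.2.2.2.2

theorem absolutelyContinuousOnInterval_of_mem_space {α : ℝ} {u : ℝ → ℝ} (hu : u ∈ space α)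
    (a b : ℝ) (ha : 0 < a) (hab : a ≤ b) : AbsolutelyContinuousOnInterval u a b :=
  absolutelyContinuousOnInterval_of_hasDerivAt (fun r hr => (hu.1 r hr).hasDerivAt)
    (continuousOn_deriv_of_mem_space hu) ha hab

theorem exists_abs_le_rpow {α : ℝ} (hα : 3 < α) {u : ℝ → ℝ} (hu : u ∈ space α) :
    ∃ K, 0 ≤ K ∧ ∀ r, 0 < r → |u r| ≤ K * r ^ (-((α - 3) / 2)) := by
  obtain ⟨K, hK0, hK⟩ := exists_abs_le_rpow_of_deriv_sq_integrable (β := α - 2) (by linarith)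
    (absolutelyContinuousOnInterval_of_mem_space hu) hu.2.2.1 (integrableOn_deriv_sq hα hu)
  refine ⟨K, hK0, fun r hr => ?_⟩
  have := hK r hr
  rwa [show α - 2 - 1 = α - 3 by ring] at this

theorem integrableOn_sq {α : ℝ} (hα : 3 < α) {u : ℝ → ℝ} (hu : u ∈ space α) :
    IntegrableOn (fun r => u r ^ 2 * r ^ (α - 4)) (Ioi 0) := by
  have := integrableOn_sq_mul_rpow_sub_two (β := α - 2) (by linarith)
    (absolutelyContinuousOnInterval_of_mem_space hu) hu.2.2.1 (integrableOn_deriv_sq hα hu)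
  rwa [show α - 2 - 2 = α - 4 by ring] at this

theorem measurable_laplacian (α : ℝ) (u : ℝ → ℝ) : Measurable (laplacian α u) :=
  (measurable_deriv _).add ((measurable_const.div measurable_id).mul (measurable_deriv _))

theorem measurable_rpow_right (γ : ℝ) : Measurable fun r : ℝ => r ^ γ :=
  measurable_id.pow_const γ

theorem aestronglyMeasurable_of_mem_space {α : ℝ} {u : ℝ → ℝ} (hu : u ∈ space α) :
    AEStronglyMeasurable u (volume.restrict (Ioi 0)) :=
  (continuousOn_of_mem_space hu).aestronglyMeasurable measurableSet_Ioi

theorem integrableOn_laplacian_sq {α : ℝ} (hα : 3 < α) {u : ℝ → ℝ} (hu : u ∈ space α) :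
    IntegrableOn (fun r => laplacian α u r ^ 2 * r ^ α) (Ioi 0) := by
  have h1 := (hu.2.2.2.2.const_mul 2).add ((integrableOn_deriv_sq hα hu).const_mul (2 * α ^ 2))
  refine Integrable.mono' h1 (((measurable_laplacian α u).pow_const 2).mul
    (measurable_rpow_right α)).aestronglyMeasurable ?_
  filter_upwards [ae_restrict_mem measurableSet_Ioi] with r hr
  have hr0 : (0 : ℝ) < r := hr
  have e : r ^ α = r ^ (α - 2) * r * r := by
    rw [← Real.rpow_add_one hr0.ne', ← Real.rpow_add_one hr0.ne']; congr 1; ring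
  have hp : 0 ≤ r ^ (α - 2) := Real.rpow_nonneg hr0.le _
  rw [Real.norm_of_nonneg (by positivity)]
  simp only [laplacian, Pi.add_apply]
  rw [e]
  set w := r ^ (α - 2)
  set d := deriv u r
  set g := deriv (deriv u) r
  have : 2 * (g ^ 2 * (w * r * r)) + 2 * α ^ 2 * (d ^ 2 * w) -
      (g + α / r * d) ^ 2 * (w * r * r) = w * (g * r - α * d) ^ 2 := by
    field_simp
    ring
  have h2 : 0 ≤ w * (g * r - α * d) ^ 2 := by positivity
  linarith

theorem two_lt_critExp {α : ℝ} (hα : 3 < α) : 2 < critExp α := by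
  rw [critExp, lt_div_iff₀ (by linarith)]; linarith

/-- The embedding of the space into `L^{2*}_α`: the exponent `2*` is the one for which the decay
`|u| ≤ K r^{-(α-3)/2}` gives `|u|^{2*-2} r^α ≤ K^{2*-2} r^{α-4}`. -/
theorem integrableOn_abs_rpow_critExp {α : ℝ} (hα : 3 < α) {u : ℝ → ℝ} (hu : u ∈ space α) :
    IntegrableOn (fun r => |u r| ^ critExp α * r ^ α) (Ioi 0) := by
  obtain ⟨K, hK0, hK⟩ := exists_abs_le_rpow hα hu
  have hp := two_lt_critExp hα
  have h1 := (integrableOn_sq hα hu).const_mul (K ^ (critExp α - 2))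
  refine Integrable.mono' h1 ?_ ?_
  · exact (((aestronglyMeasurable_of_mem_space hu).aemeasurable.norm.pow_const _).mul
      (measurable_rpow_right α).aemeasurable).aestronglyMeasurable
  filter_upwards [ae_restrict_mem measurableSet_Ioi] with r hr
  have hr0 : (0 : ℝ) < r := hr
  rw [Real.norm_of_nonneg (by positivity)]
  have e1 : |u r| ^ critExp α = |u r| ^ (critExp α - 2) * u r ^ 2 := by
    rw [← sq_abs (u r), ← Real.rpow_two, ← Real.rpow_add' (abs_nonneg _) (by linarith)]
    congr 1; ring
  have e2 : |u r| ^ (critExp α - 2) ≤ K ^ (critExp α - 2) * r ^ (-4 : ℝ) := by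
    calc |u r| ^ (critExp α - 2) ≤ (K * r ^ (-((α - 3) / 2))) ^ (critExp α - 2) :=
          Real.rpow_le_rpow (abs_nonneg _) (hK r hr0) (by linarith)
      _ = K ^ (critExp α - 2) * r ^ (-4 : ℝ) := by
          rw [Real.mul_rpow hK0 (by positivity), ← Real.rpow_mul hr0.le]
          congr 2
          rw [critExp]
          have : α - 3 ≠ 0 := by linarith
          field_simp
          ring
  calc |u r| ^ critExp α * r ^ α
      = |u r| ^ (critExp α - 2) * (u r ^ 2 * r ^ α) := by rw [e1]; ring
    _ ≤ K ^ (critExp α - 2) * r ^ (-4 : ℝ) * (u r ^ 2 * r ^ α) := by gcongr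
    _ = K ^ (critExp α - 2) * (u r ^ 2 * (r ^ α * r ^ (-4 : ℝ))) := by ring
    _ = _ := by rw [← Real.rpow_add hr0]; rfl

theorem hasDerivAt_add_mul {α : ℝ} {u v : ℝ → ℝ} (hu : u ∈ space α) (hv : v ∈ space α) (t : ℝ)
    {r : ℝ} (hr : 0 < r) :
    HasDerivAt (fun x => u x + t * v x) (deriv u r + t * deriv v r) r :=
  (hu.1 r hr).hasDerivAt.fun_add ((hv.1 r hr).hasDerivAt.const_mul t)

theorem deriv_add_mul_eventuallyEq {α : ℝ} {u v : ℝ → ℝ} (hu : u ∈ space α) (hv : v ∈ space α)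
    (t : ℝ) {r : ℝ} (hr : 0 < r) :
    deriv (fun x => u x + t * v x) =ᶠ[𝓝 r] fun x => deriv u x + t * deriv v x := by
  filter_upwards [Ioi_mem_nhds hr] with x hx using (hasDerivAt_add_mul hu hv t hx).deriv

theorem deriv_deriv_add_mul_ae {α : ℝ} {u v : ℝ → ℝ} (hu : u ∈ space α) (hv : v ∈ space α)
    (t : ℝ) : ∀ᵐ r ∂(volume.restrict (Ioi (0 : ℝ))),
      deriv (deriv fun x => u x + t * v x) r = deriv (deriv u) r + t * deriv (deriv v) r := by
  filter_upwards [ae_differentiableAt_of_absolutelyContinuousOnInterval hu.2.1,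
    ae_differentiableAt_of_absolutelyContinuousOnInterval hv.2.1,
    ae_restrict_mem measurableSet_Ioi] with r h1 h2 hr
  rw [(deriv_add_mul_eventuallyEq hu hv t hr).deriv_eq]
  exact (h1.hasDerivAt.fun_add (h2.hasDerivAt.const_mul t)).deriv

theorem laplacian_add_mul_ae {α : ℝ} {u v : ℝ → ℝ} (hu : u ∈ space α) (hv : v ∈ space α)
    (t : ℝ) : ∀ᵐ r ∂(volume.restrict (Ioi (0 : ℝ))),
      laplacian α (fun x => u x + t * v x) r = laplacian α u r + t * laplacian α v r := by
  filter_upwards [deriv_deriv_add_mul_ae hu hv t, ae_restrict_mem measurableSet_Ioi] with r h1 hr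
  simp only [laplacian, h1, (hasDerivAt_add_mul hu hv t hr).deriv]
  ring

theorem absolutelyContinuousOnInterval_congr {f g : ℝ → ℝ} {a b : ℝ}
    (hf : AbsolutelyContinuousOnInterval f a b) (hfg : EqOn f g (uIcc a b)) :
    AbsolutelyContinuousOnInterval g a b := by
  rw [absolutelyContinuousOnInterval_iff] at hf ⊢
  intro ε hε
  obtain ⟨δ, hδ, h⟩ := hf ε hε
  refine ⟨δ, hδ, fun E hE hEs => ?_⟩
  refine lt_of_eq_of_lt (Finset.sum_congr rfl fun i hi => ?_) (h E hE hEs)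
  rw [hfg (hE.1 i hi).1, hfg (hE.1 i hi).2]

theorem add_mul_mem_space {α : ℝ} {u v : ℝ → ℝ} (hu : u ∈ space α) (hv : v ∈ space α) (t : ℝ) :
    (fun x => u x + t * v x) ∈ space α := by
  refine ⟨fun r hr => (hasDerivAt_add_mul hu hv t hr).differentiableAt, fun a b ha hab => ?_, ?_,
    ?_, ?_⟩
  · refine absolutelyContinuousOnInterval_congr
      ((hu.2.1 a b ha hab).fun_add ((hv.2.1 a b ha hab).const_mul t)) fun r hr => ?_
    rw [uIcc_of_le hab] at hr
    exact (hasDerivAt_add_mul hu hv t (ha.trans_le hr.1)).deriv.symm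
  · simpa using hu.2.2.1.add (hv.2.2.1.const_mul t)
  · have : Tendsto (fun r => deriv u r + t * deriv v r) atTop (𝓝 0) := by
      simpa using hu.2.2.2.1.add (hv.2.2.2.1.const_mul t)
    refine this.congr' ?_
    filter_upwards [eventually_gt_atTop 0] with r hr
    exact (hasDerivAt_add_mul hu hv t hr).deriv.symm
  · have h1 := (hu.2.2.2.2.const_mul 2).add (hv.2.2.2.2.const_mul (2 * t ^ 2))
    refine Integrable.mono' h1 (((measurable_deriv _).pow_const 2).mul
      (measurable_rpow_right α)).aestronglyMeasurable ?_
    filter_upwards [deriv_deriv_add_mul_ae hu hv t, ae_restrict_mem measurableSet_Ioi]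
      with r h2 hr
    have hr0 : (0 : ℝ) < r := hr
    have hp : 0 ≤ r ^ α := Real.rpow_nonneg hr0.le _
    rw [Real.norm_of_nonneg (by positivity), h2]
    simp only [Pi.add_apply]
    nlinarith [mul_nonneg hp (sq_nonneg (deriv (deriv u) r - t * deriv (deriv v) r))]

theorem integrableOn_laplacian_mul {α : ℝ} (hα : 3 < α) {u v : ℝ → ℝ} (hu : u ∈ space α)
    (hv : v ∈ space α) :
    IntegrableOn (fun r => laplacian α u r * laplacian α v r * r ^ α) (Ioi 0) := by
  refine Integrable.mono' ((integrableOn_laplacian_sq hα hu).add (integrableOn_laplacian_sq hα hv))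
    (((measurable_laplacian α u).mul (measurable_laplacian α v)).mul
      (measurable_rpow_right α)).aestronglyMeasurable ?_
  filter_upwards [ae_restrict_mem measurableSet_Ioi] with r hr
  have hr0 : (0 : ℝ) < r := hr
  have hp : 0 ≤ r ^ α := Real.rpow_nonneg hr0.le _
  rw [norm_mul, Real.norm_of_nonneg hp, Real.norm_eq_abs, abs_mul]
  simp only [Pi.add_apply]
  rw [← add_mul, ← sq_abs (laplacian α u r), ← sq_abs (laplacian α v r)]
  refine mul_le_mul_of_nonneg_right ?_ hp
  nlinarith [sq_nonneg (|laplacian α u r| - |laplacian α v r|), sq_nonneg (|laplacian α u r|),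
    sq_nonneg (|laplacian α v r|)]

/-! ### The potential of the indicator function of a ball -/

/-- The decaying solution `v` of `Δ_α v = 1_{(0, b)}`, written with `min` and `max` so that its
continuity is visible: it is `r² / (2(α+1)) - b² / (2(α-1))` on `(0, b]` and
`-b^{α+1} r^{1-α} / ((α+1)(α-1))` on `[b, ∞)`. -/
noncomputable def ballPotential (α b r : ℝ) : ℝ :=
  (min r b ^ 2 - b ^ 2) / (2 * (α + 1)) -
    b ^ (α + 1) * max r b ^ (1 - α) / ((α + 1) * (α - 1))

/-- The derivative of `ballPotential`: `r / (α+1)` on `(0, b]` and `b^{α+1} r^{-α} / (α+1)` on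
`[b, ∞)`. -/
noncomputable def ballPotentialDeriv (α b r : ℝ) : ℝ :=
  (min r b - b + b ^ (α + 1) * max r b ^ (-α)) / (α + 1)

theorem ballPotential_of_le {α b r : ℝ} (hα : 1 < α) (hb : 0 < b) (h : r ≤ b) :
    ballPotential α b r = r ^ 2 / (2 * (α + 1)) - b ^ 2 / (2 * (α - 1)) := by
  have e : b ^ (α + 1) * b ^ (1 - α) = b ^ 2 := by
    rw [← Real.rpow_add hb, ← Real.rpow_two]; congr 1; ring
  rw [ballPotential, min_eq_left h, max_eq_right h, e]
  have h1 : α - 1 ≠ 0 := by linarith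
  have h2 : α + 1 ≠ 0 := by linarith
  field_simp
  ring

theorem ballPotential_of_ge {α b r : ℝ} (h : b ≤ r) :
    ballPotential α b r = -(b ^ (α + 1) / ((α + 1) * (α - 1)) * r ^ (1 - α)) := by
  rw [ballPotential, min_eq_right h, max_eq_left h]
  ring

theorem ballPotentialDeriv_of_le {α b r : ℝ} (hb : 0 < b) (h : r ≤ b) :
    ballPotentialDeriv α b r = r / (α + 1) := by
  have e : b ^ (α + 1) * b ^ (-α) = b := by
    rw [← Real.rpow_add hb, show α + 1 + -α = 1 by ring, Real.rpow_one]
  rw [ballPotentialDeriv, min_eq_left h, max_eq_right h, e]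
  ring

theorem ballPotentialDeriv_of_ge {α b r : ℝ} (h : b ≤ r) :
    ballPotentialDeriv α b r = b ^ (α + 1) / (α + 1) * r ^ (-α) := by
  rw [ballPotentialDeriv, min_eq_right h, max_eq_left h]
  ring

theorem continuous_max_rpow {b : ℝ} (hb : 0 < b) (γ : ℝ) :
    Continuous fun r : ℝ => max r b ^ γ :=
  (continuous_id.max continuous_const).rpow_const
    fun r => Or.inl (hb.trans_le (le_max_right r b)).ne'

theorem hasDerivAt_ballPotential {α b : ℝ} (hα : 1 < α) (hb : 0 < b) (r : ℝ) :
    HasDerivAt (ballPotential α b) (ballPotentialDeriv α b r) r := by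
  refine hasDerivAt_of_hasDerivAt_of_ne' (x := b) (fun y hy => ?_) ?_ ?_ r
  · rcases lt_or_gt_of_ne hy with h | h
    · rw [ballPotentialDeriv_of_le hb h.le]
      have h1 : HasDerivAt (fun r : ℝ => r ^ 2 / (2 * (α + 1)) - b ^ 2 / (2 * (α - 1)))
          (y / (α + 1)) y := by
        refine ((((hasDerivAt_id y).fun_pow 2).div_const (2 * (α + 1))).sub_const _).congr_deriv ?_
        simp only [id, Nat.cast_ofNat]
        have h2 : α + 1 ≠ 0 := by linarith
        field_simp
        ring
      refine h1.congr_of_eventuallyEq ?_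
      filter_upwards [Iio_mem_nhds h] with x hx using ballPotential_of_le hα hb (le_of_lt hx)
    · rw [ballPotentialDeriv_of_ge (le_of_lt h)]
      have h1 : HasDerivAt (fun r : ℝ => -(b ^ (α + 1) / ((α + 1) * (α - 1)) * r ^ (1 - α)))
          (b ^ (α + 1) / (α + 1) * y ^ (-α)) y := by
        refine ((Real.hasDerivAt_rpow_const (p := 1 - α)
          (Or.inl (hb.trans h).ne')).const_mul _).fun_neg.congr_deriv ?_
        rw [show 1 - α - 1 = -α by ring]
        have h2 : α + 1 ≠ 0 := by linarith
        have h3 : α - 1 ≠ 0 := by linarith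
        field_simp
        ring
      refine h1.congr_of_eventuallyEq ?_
      filter_upwards [Ioi_mem_nhds h] with x hx using ballPotential_of_ge (le_of_lt hx)
  · refine Continuous.continuousAt ?_
    exact ((((continuous_id.min continuous_const).pow 2).sub continuous_const).div_const _).sub
      ((continuous_const.mul (continuous_max_rpow hb _)).div_const _)
  · refine Continuous.continuousAt ?_
    exact (((continuous_id.min continuous_const).sub continuous_const).add
      (continuous_const.mul (continuous_max_rpow hb _))).div_const _

theorem deriv_ballPotential {α b : ℝ} (hα : 1 < α) (hb : 0 < b) :
    deriv (ballPotential α b) = ballPotentialDeriv α b :=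
  funext fun r => (hasDerivAt_ballPotential hα hb r).deriv

theorem deriv_ballPotentialDeriv_of_lt {α b r : ℝ} (hb : 0 < b) (h : r < b) :
    deriv (ballPotentialDeriv α b) r = 1 / (α + 1) := by
  refine HasDerivAt.deriv (((hasDerivAt_id r).div_const (α + 1)).congr_of_eventuallyEq ?_)
  filter_upwards [Iio_mem_nhds h] with x hx using ballPotentialDeriv_of_le hb (le_of_lt hx)

theorem deriv_ballPotentialDeriv_of_gt {α b r : ℝ} (hb : 0 < b) (h : b < r) :
    deriv (ballPotentialDeriv α b) r = b ^ (α + 1) / (α + 1) * (-α * r ^ (-α - 1)) := by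
  refine HasDerivAt.deriv (((Real.hasDerivAt_rpow_const (p := -α)
    (Or.inl (hb.trans h).ne')).const_mul (b ^ (α + 1) / (α + 1))).congr_of_eventuallyEq ?_)
  filter_upwards [Ioi_mem_nhds h] with x hx using ballPotentialDeriv_of_ge (le_of_lt hx)

theorem laplacian_ballPotential_of_lt {α b r : ℝ} (hα : 1 < α) (hb : 0 < b) (hr : 0 < r)
    (h : r < b) : laplacian α (ballPotential α b) r = 1 := by
  rw [laplacian, deriv_ballPotential hα hb, deriv_ballPotentialDeriv_of_lt hb h,
    ballPotentialDeriv_of_le hb h.le]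
  have h2 : α + 1 ≠ 0 := by linarith
  field_simp
  ring

theorem laplacian_ballPotential_of_gt {α b r : ℝ} (hα : 1 < α) (hb : 0 < b)
    (h : b < r) : laplacian α (ballPotential α b) r = 0 := by
  have hr := hb.trans h
  rw [laplacian, deriv_ballPotential hα hb, deriv_ballPotentialDeriv_of_gt hb h,
    ballPotentialDeriv_of_ge h.le, Real.rpow_sub_one hr.ne']
  field_simp
  ring

theorem lipschitzOnWith_ballPotentialDeriv {α b : ℝ} (hb : 0 < b) (a c : ℝ)
    (hc : b ≤ c) : ∃ K, LipschitzOnWith K (ballPotentialDeriv α b) (Icc a c) := by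
  have h1 : ContDiffOn ℝ 1 (fun x : ℝ => x ^ (-α)) (Icc b c) := fun x hx =>
    (Real.contDiffAt_rpow_const_of_ne (hb.trans_le hx.1).ne').contDiffWithinAt
  obtain ⟨K, hK⟩ := h1.exists_lipschitzOnWith (by decide) (convex_Icc _ _) isCompact_Icc
  have hmax : LipschitzWith 1 fun r : ℝ => max r b := LipschitzWith.id.max_const b
  have hmin : LipschitzWith 1 fun r : ℝ => min r b := LipschitzWith.id.min_const b
  have h2 : LipschitzOnWith (K * 1) (fun r : ℝ => max r b ^ (-α)) (Icc a c) :=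
    hK.comp (hmax.lipschitzOnWith (s := Icc a c)) fun r hr =>
      ⟨le_max_right _ _, max_le hr.2 hc⟩
  have hd : ballPotentialDeriv α b = fun r => (α + 1)⁻¹ • (min r b - b) +
      (b ^ (α + 1) / (α + 1)) • max r b ^ (-α) := by
    funext r
    simp only [ballPotentialDeriv, smul_eq_mul]
    ring
  rw [hd]
  have h3 : LipschitzOnWith _ (fun r : ℝ => (α + 1)⁻¹ • (min r b - b)) (Icc a c) :=
    ((lipschitzWith_smul (α + 1)⁻¹).comp
      (hmin.sub (LipschitzWith.const b))).lipschitzOnWith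
  have h4 : LipschitzOnWith _ (fun r : ℝ => (b ^ (α + 1) / (α + 1)) • max r b ^ (-α))
      (Icc a c) := (lipschitzWith_smul (b ^ (α + 1) / (α + 1))).comp_lipschitzOnWith h2
  exact ⟨_, h3.add h4⟩

theorem ballPotential_mem_space {α b : ℝ} (hα : 3 < α) (hb : 0 < b) :
    ballPotential α b ∈ space α := by
  have hα1 : 1 < α := by linarith
  refine ⟨fun r _ => (hasDerivAt_ballPotential hα1 hb r).differentiableAt, ?_, ?_, ?_, ?_⟩ <;>
    try simp only [deriv_ballPotential hα1 hb]
  · intro a c ha hac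
    obtain ⟨K, hK⟩ := lipschitzOnWith_ballPotentialDeriv hb a (max c b) (le_max_right _ _)
    refine (hK.mono ?_).absolutelyContinuousOnInterval
    rw [uIcc_of_le hac]
    exact Icc_subset_Icc_right (le_max_left _ _)
  · have h1 : Tendsto (fun r : ℝ => -(b ^ (α + 1) / ((α + 1) * (α - 1)) * r ^ (-(α - 1))))
        atTop (𝓝 0) := by
      simpa using ((tendsto_rpow_neg_atTop (show 0 < α - 1 by linarith)).const_mul
        (b ^ (α + 1) / ((α + 1) * (α - 1)))).neg
    refine h1.congr' ?_
    filter_upwards [eventually_ge_atTop b] with r hr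
    rw [ballPotential_of_ge hr, show -(α - 1) = 1 - α by ring]
  · have h1 : Tendsto (fun r : ℝ => b ^ (α + 1) / (α + 1) * r ^ (-α)) atTop (𝓝 0) := by
      simpa using (tendsto_rpow_neg_atTop (show 0 < α by linarith)).const_mul
        (b ^ (α + 1) / (α + 1))
    refine h1.congr' ?_
    filter_upwards [eventually_ge_atTop b] with r hr
    rw [ballPotentialDeriv_of_ge hr]
  · rw [← Ioc_union_Ioi_eq_Ioi hb.le]
    refine IntegrableOn.union ?_ ?_
    · have h1 : IntegrableOn (fun r : ℝ => (1 / (α + 1)) ^ 2 * r ^ α) (Ioo 0 b) :=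
        ((((intervalIntegral.intervalIntegrable_rpow' (by linarith)).const_mul _).1).mono_set
          Ioo_subset_Ioc_self)
      rw [integrableOn_Ioc_iff_integrableOn_Ioo]
      exact h1.congr_fun (fun r hr => by
        simp only [deriv_ballPotentialDeriv_of_lt hb hr.2]) measurableSet_Ioo
    · have h1 : IntegrableOn (fun r : ℝ => (b ^ (α + 1) / (α + 1) * α) ^ 2 * r ^ (-α - 2))
          (Ioi b) := (integrableOn_Ioi_rpow_of_lt (by linarith) hb).const_mul _
      refine h1.congr_fun (fun r hr => ?_) measurableSet_Ioi
      have hr0 : 0 < r := hb.trans hr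
      simp only [deriv_ballPotentialDeriv_of_gt hb hr]
      have e : r ^ (-α - 2) = r ^ (-α - 1) * r ^ (-α - 1) * r ^ α := by
        rw [← Real.rpow_add hr0, ← Real.rpow_add hr0]; congr 1; ring
      rw [e]
      ring

theorem integrableOn_laplacian_Ioc {α : ℝ} (hα : 3 < α) {u : ℝ → ℝ} (hu : u ∈ space α) (b : ℝ) :
    IntegrableOn (fun r => laplacian α u r * r ^ α) (Ioc 0 b) := by
  have h1 : IntegrableOn (fun r : ℝ => r ^ α) (Ioc 0 b) :=
    (intervalIntegral.intervalIntegrable_rpow' (by linarith)).1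
  refine Integrable.mono' (((integrableOn_laplacian_sq hα hu).mono_set Ioc_subset_Ioi_self).add h1)
    ((measurable_laplacian α u).mul (measurable_rpow_right α)).aestronglyMeasurable ?_
  filter_upwards [ae_restrict_mem measurableSet_Ioc] with r hr
  have hr0 : (0 : ℝ) < r := hr.1
  have hp : 0 ≤ r ^ α := Real.rpow_nonneg hr0.le _
  rw [norm_mul, Real.norm_of_nonneg hp, Real.norm_eq_abs, Pi.add_apply, ← sq_abs,
    show ∀ x : ℝ, x * r ^ α + r ^ α = (x + 1) * r ^ α by intro x; ring]
  refine mul_le_mul_of_nonneg_right ?_ hp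
  nlinarith [sq_nonneg (|laplacian α u r| - 1), abs_nonneg (laplacian α u r)]

/-- The divergence theorem `∫₀^b Δ_α u r^α dr = b^α u'(b)`; the boundary term at `0` vanishes
because `u' = O(r^{-(α-1)/2})`. -/
theorem integral_laplacian_Ioc {α : ℝ} (hα : 3 < α) {u : ℝ → ℝ} (hu : u ∈ space α) {b : ℝ}
    (hb : 0 < b) : ∫ r in Ioc 0 b, laplacian α u r * r ^ α = b ^ α * deriv u b := by
  have hfi := integrableOn_laplacian_Ioc hα hu b
  have h1 : ∀ a, 0 < a → a ≤ b →
      ∫ r in a..b, laplacian α u r * r ^ α = b ^ α * deriv u b - a ^ α * deriv u a := by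
    intro a ha hab
    have hgac : AbsolutelyContinuousOnInterval (fun r : ℝ => r ^ α) a b :=
      absolutelyContinuousOnInterval_of_hasDerivAt
        (f' := fun r => α * r ^ (α - 1))
        (fun r hr => Real.hasDerivAt_rpow_const (Or.inl hr.ne'))
        (continuousOn_const.mul (continuousOn_rpow_Ioi _)) ha hab
    rw [← (hgac.fun_mul (hu.2.1 a b ha hab)).integral_deriv_eq_sub]
    refine intervalIntegral.integral_congr_ae_restrict ?_
    rw [uIoc_of_le hab]
    have hd := ae_restrict_of_ae_restrict_of_subset
      (fun x (hx : x ∈ Ioc a b) => (ha.trans hx.1 : x ∈ Ioi 0))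
      (ae_differentiableAt_of_absolutelyContinuousOnInterval hu.2.1)
    filter_upwards [hd, ae_restrict_mem measurableSet_Ioc] with r hr hrm
    have hr0 : 0 < r := ha.trans hrm.1
    rw [((Real.hasDerivAt_rpow_const (p := α) (Or.inl hr0.ne')).fun_mul hr.hasDerivAt).deriv,
      laplacian, Real.rpow_sub_one hr0.ne']
    ring
  obtain ⟨K, hK0, hK⟩ := exists_abs_deriv_le_rpow hα hu
  have hz : Tendsto (fun a => a ^ α * deriv u a) (𝓝[>] 0) (𝓝 0) := by
    have h2 : Tendsto (fun a : ℝ => K * a ^ ((α + 1) / 2)) (𝓝[>] 0) (𝓝 0) := by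
      have h3 : ContinuousAt (fun a : ℝ => K * a ^ ((α + 1) / 2)) 0 :=
        continuousAt_const.mul (Real.continuousAt_rpow_const _ _ (Or.inr (by linarith)))
      have h4 := h3.tendsto.mono_left (nhdsWithin_le_nhds (s := Ioi 0))
      rwa [Real.zero_rpow (by linarith), mul_zero] at h4
    refine squeeze_zero_norm' ?_ h2
    filter_upwards [self_mem_nhdsWithin] with a ha
    have ha0 : (0 : ℝ) < a := ha
    rw [norm_mul, Real.norm_of_nonneg (by positivity), Real.norm_eq_abs]
    calc a ^ α * |deriv u a| ≤ a ^ α * (K * a ^ (-((α - 1) / 2))) := by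
          gcongr; exact hK a ha0
      _ = K * (a ^ α * a ^ (-((α - 1) / 2))) := by ring
      _ = K * a ^ ((α + 1) / 2) := by
          rw [← Real.rpow_add ha0]; congr 2; ring
  have h5 : Tendsto (fun a => ∫ r in a..b, laplacian α u r * r ^ α) (𝓝[>] 0)
      (𝓝 (∫ r in (0 : ℝ)..b, laplacian α u r * r ^ α)) := by
    have h6 := intervalIntegral.continuousOn_primitive_interval_left (a := 0) (b := b)
      (f := fun r => laplacian α u r * r ^ α) (μ := volume)
      (by rw [uIcc_of_le hb.le, integrableOn_Icc_iff_integrableOn_Ioc]; exact hfi)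
    have h7 := h6 0 left_mem_uIcc
    rw [uIcc_of_le hb.le] at h7
    refine h7.tendsto.mono_left ?_
    rw [← nhdsWithin_Ioo_eq_nhdsGT hb]
    exact nhdsWithin_mono _ Ioo_subset_Icc_self
  rw [← intervalIntegral.integral_of_le hb.le]
  refine tendsto_nhds_unique h5 ?_
  have h8 : Tendsto (fun a => b ^ α * deriv u b - a ^ α * deriv u a) (𝓝[>] 0)
      (𝓝 (b ^ α * deriv u b)) := by simpa using hz.const_sub (b ^ α * deriv u b)
  refine h8.congr' ?_
  filter_upwards [Ioo_mem_nhdsGT hb] with a ha using (h1 a ha.1 ha.2.le).symm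

/-- Testing with `ballPotential` recovers `u'`. -/
theorem integral_laplacian_mul_ballPotential {α : ℝ} (hα : 3 < α) {u : ℝ → ℝ} (hu : u ∈ space α)
    {b : ℝ} (hb : 0 < b) :
    ∫ r in Ioi (0 : ℝ), laplacian α u r * laplacian α (ballPotential α b) r * r ^ α =
      b ^ α * deriv u b := by
  have hα1 : 1 < α := by linarith
  rw [← integral_laplacian_Ioc hα hu hb, ← integral_indicator measurableSet_Ioi,
    ← integral_indicator measurableSet_Ioc]
  refine integral_congr_ae ?_
  have hne : ∀ᵐ r : ℝ, r ≠ b := by simp [ae_iff, measure_singleton]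
  filter_upwards [hne] with r hrb
  rcases le_or_gt r 0 with h0 | h0
  · rw [indicator_of_notMem (by simpa using h0), indicator_of_notMem (by simp [h0])]
  · rw [indicator_of_mem (show r ∈ Ioi 0 from h0)]
    rcases lt_or_gt_of_ne hrb with h | h
    · rw [indicator_of_mem (show r ∈ Ioc 0 b from ⟨h0, h.le⟩),
        laplacian_ballPotential_of_lt hα1 hb h0 h, mul_one]
    · rw [indicator_of_notMem (show r ∉ Ioc 0 b from fun h' => (h'.2.trans_lt h).false),
        laplacian_ballPotential_of_gt hα1 hb h, mul_zero, zero_mul]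

/-! ### Linear regularity theory -/

/-- The moment `∫₀^r f(s) s^γ ds`. -/
noncomputable def moment (γ : ℝ) (f : ℝ → ℝ) (r : ℝ) : ℝ := ∫ s in (0 : ℝ)..r, f s * s ^ γ

/-- The tail integral `∫_r^∞ f(s) s ds`. -/
noncomputable def tail (f : ℝ → ℝ) (r : ℝ) : ℝ := ∫ s in Ioi r, f s * s

/-- The first derivative of the decaying solution of `Δ_α² u = f`, regular at the origin. -/
noncomputable def greenDeriv1 (α : ℝ) (f : ℝ → ℝ) (r : ℝ) : ℝ :=
  moment (α + 2) f r / r ^ α / (2 * (α + 1)) - moment α f r * r ^ 2 / r ^ α / (2 * (α - 1)) -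
    r * tail f r / ((α + 1) * (α - 1))

/-- The second derivative of the decaying solution of `Δ_α² u = f`, regular at the origin. -/
noncomputable def greenDeriv2 (α : ℝ) (f : ℝ → ℝ) (r : ℝ) : ℝ :=
  -α * (moment (α + 2) f r / (r ^ α * r)) / (2 * (α + 1)) +
    (α - 2) * (moment α f r * r / r ^ α) / (2 * (α - 1)) - tail f r / ((α + 1) * (α - 1))

/-- The third derivative of the decaying solution of `Δ_α² u = f`, regular at the origin. -/
noncomputable def greenDeriv3 (α : ℝ) (f : ℝ → ℝ) (r : ℝ) : ℝ :=
  α / 2 * (moment (α + 2) f r / (r ^ α * r ^ 2)) + (2 - α) / 2 * (moment α f r / r ^ α)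

/-- The fourth derivative of the decaying solution of `Δ_α² u = f`, regular at the origin. -/
noncomputable def greenDeriv4 (α : ℝ) (f : ℝ → ℝ) (r : ℝ) : ℝ :=
  -α * (α + 2) / 2 * (moment (α + 2) f r / (r ^ α * r ^ 3)) +
    α * (α - 2) / 2 * (moment α f r / (r ^ α * r)) + f r

/-- The Laplacian of the decaying solution of `Δ_α² u = f`, regular at the origin. -/
noncomputable def greenLaplacian (α : ℝ) (f : ℝ → ℝ) (r : ℝ) : ℝ :=
  -(moment α f r * r / r ^ α + tail f r) / (α - 1)

section

variable {α γ : ℝ} {f : ℝ → ℝ}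

theorem hasDerivAt_moment (hf : Continuous f) (hγ : 0 < γ) (r : ℝ) :
    HasDerivAt (moment γ f) (f r * r ^ γ) r := by
  have hc : Continuous fun s : ℝ => f s * s ^ γ := hf.mul (Real.continuous_rpow_const hγ.le)
  exact (hc.integral_hasStrictDerivAt 0 r).hasDerivAt

theorem hasDerivAt_tail (hf : Continuous f) (hfi : IntegrableOn (fun r => f r * r) (Ioi 0))
    {r : ℝ} (hr : 0 < r) : HasDerivAt (tail f) (-(f r * r)) r := by
  have hc : Continuous fun s : ℝ => f s * s := hf.mul continuous_id
  refine (((hc.integral_hasStrictDerivAt 0 r).hasDerivAt).const_sub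
    (tail f 0)).congr_of_eventuallyEq ?_
  filter_upwards [Ioi_mem_nhds hr] with x hx
  have hx0 : 0 < x := hx
  have := intervalIntegral.integral_interval_add_Ioi' (a := 0) (b := x) (f := fun s => f s * s)
    (μ := volume) (hc.intervalIntegrable 0 x) (hfi.mono_set (Ioi_subset_Ioi hx0.le))
  simp only [tail]
  linarith

theorem hasDerivAt_rpow_div {r : ℝ} (hr : 0 < r) :
    HasDerivAt (fun x : ℝ => x ^ α) (α * r ^ α / r) r :=
  (Real.hasDerivAt_rpow_const (Or.inl hr.ne')).congr_deriv (by
    rw [Real.rpow_sub_one hr.ne']; ring)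

theorem rpow_add_two {r : ℝ} (hr : 0 < r) : r ^ (α + 2) = r ^ α * r ^ 2 := by
  rw [Real.rpow_add hr, Real.rpow_two]

/-- In the derivative of `greenDeriv1` the three terms containing `f r` cancel; the same happens in
the derivative of `greenDeriv2`, and a single `f r` remains in that of `greenDeriv3`. -/
theorem hasDerivAt_greenDeriv1 (hα : 1 < α) (hf : Continuous f)
    (hfi : IntegrableOn (fun r => f r * r) (Ioi 0)) {r : ℝ} (hr : 0 < r) :
    HasDerivAt (greenDeriv1 α f) (greenDeriv2 α f r) r := by
  have hw : r ^ α ≠ 0 := (Real.rpow_pos_of_pos hr α).ne'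
  have hA := hasDerivAt_moment hf (show 0 < α + 2 by linarith) r
  have hB := hasDerivAt_moment hf (show 0 < α by linarith) r
  have hC := hasDerivAt_tail hf hfi hr
  have hW := hasDerivAt_rpow_div (α := α) hr
  have h := ((((hA.fun_div hW hw).div_const (2 * (α + 1))).fun_sub
    (((hB.fun_mul ((hasDerivAt_id' r).fun_pow 2)).fun_div hW hw).div_const (2 * (α - 1)))).fun_sub
    (((hasDerivAt_id' r).fun_mul hC).div_const ((α + 1) * (α - 1))))
  refine h.congr_deriv ?_
  rw [rpow_add_two hr, greenDeriv2]
  have h1 : α - 1 ≠ 0 := by linarith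
  have h2 : α + 1 ≠ 0 := by linarith
  push_cast
  field_simp
  ring

theorem hasDerivAt_greenDeriv2 (hα : 1 < α) (hf : Continuous f)
    (hfi : IntegrableOn (fun r => f r * r) (Ioi 0)) {r : ℝ} (hr : 0 < r) :
    HasDerivAt (greenDeriv2 α f) (greenDeriv3 α f r) r := by
  have hw : r ^ α ≠ 0 := (Real.rpow_pos_of_pos hr α).ne'
  have hA := hasDerivAt_moment hf (show 0 < α + 2 by linarith) r
  have hB := hasDerivAt_moment hf (show 0 < α by linarith) r
  have hC := hasDerivAt_tail hf hfi hr
  have hW := hasDerivAt_rpow_div (α := α) hr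
  have h := (((((hA.fun_div (hW.fun_mul (hasDerivAt_id' r)) (by positivity)).const_mul
    (-α)).div_const (2 * (α + 1))).fun_add
    ((((hB.fun_mul (hasDerivAt_id' r)).fun_div hW hw).const_mul (α - 2)).div_const
      (2 * (α - 1)))).fun_sub (hC.div_const ((α + 1) * (α - 1))))
  refine h.congr_deriv ?_
  rw [rpow_add_two hr, greenDeriv3]
  have h1 : α - 1 ≠ 0 := by linarith
  have h2 : α + 1 ≠ 0 := by linarith
  field_simp
  ring

theorem hasDerivAt_greenDeriv3 (hα : 1 < α) (hf : Continuous f) {r : ℝ} (hr : 0 < r) :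
    HasDerivAt (greenDeriv3 α f) (greenDeriv4 α f r) r := by
  have hw : r ^ α ≠ 0 := (Real.rpow_pos_of_pos hr α).ne'
  have hA := hasDerivAt_moment hf (show 0 < α + 2 by linarith) r
  have hB := hasDerivAt_moment hf (show 0 < α by linarith) r
  have hW := hasDerivAt_rpow_div (α := α) hr
  have h := ((hA.fun_div (hW.fun_mul ((hasDerivAt_id' r).fun_pow 2)) (by positivity)).const_mul
    (α / 2)).fun_add ((hB.fun_div hW hw).const_mul ((2 - α) / 2))
  refine h.congr_deriv ?_
  rw [rpow_add_two hr, greenDeriv4]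
  push_cast
  field_simp
  ring

theorem hasDerivAt_greenLaplacian (hα : 1 < α) (hf : Continuous f)
    (hfi : IntegrableOn (fun r => f r * r) (Ioi 0)) {r : ℝ} (hr : 0 < r) :
    HasDerivAt (greenLaplacian α f) (moment α f r / r ^ α) r := by
  have hw : r ^ α ≠ 0 := (Real.rpow_pos_of_pos hr α).ne'
  have hB := hasDerivAt_moment hf (show 0 < α by linarith) r
  have hC := hasDerivAt_tail hf hfi hr
  have hW := hasDerivAt_rpow_div (α := α) hr
  have h := (((hB.fun_mul (hasDerivAt_id' r)).fun_div hW hw).fun_add hC).fun_neg.div_const (α - 1)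
  refine h.congr_deriv ?_
  have h1 : α - 1 ≠ 0 := by linarith
  field_simp
  ring

theorem hasDerivAt_rpow_mul_greenDeriv1 (hα : 1 < α) (hf : Continuous f)
    (hfi : IntegrableOn (fun r => f r * r) (Ioi 0)) {r : ℝ} (hr : 0 < r) :
    HasDerivAt (fun x => x ^ α * greenDeriv1 α f x) (r ^ α * greenLaplacian α f r) r := by
  have hw : r ^ α ≠ 0 := (Real.rpow_pos_of_pos hr α).ne'
  refine ((hasDerivAt_rpow_div hr).fun_mul (hasDerivAt_greenDeriv1 hα hf hfi hr)).congr_deriv ?_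
  rw [greenDeriv1, greenDeriv2, greenLaplacian]
  have h1 : α - 1 ≠ 0 := by linarith
  have h2 : α + 1 ≠ 0 := by linarith
  field_simp
  ring

theorem continuousOn_greenDeriv4 (hα : 1 < α) (hf : Continuous f) :
    ContinuousOn (greenDeriv4 α f) (Ioi 0) := by
  intro r hr
  have hr0 : (0 : ℝ) < r := hr
  have hA := (hasDerivAt_moment hf (show 0 < α + 2 by linarith) r).continuousAt
  have hB := (hasDerivAt_moment hf (show 0 < α by linarith) r).continuousAt
  have hW := (hasDerivAt_rpow_div (α := α) hr0).continuousAt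
  have hw : r ^ α ≠ 0 := (Real.rpow_pos_of_pos hr0 α).ne'
  have hI : ContinuousAt (fun x : ℝ => x) r := continuousAt_id
  exact (((continuousAt_const.mul (hA.div (hW.mul (hI.pow 3))
    (mul_ne_zero hw (pow_ne_zero 3 hr0.ne')))).add
    (continuousAt_const.mul (hB.div (hW.mul hI) (mul_ne_zero hw hr0.ne')))).add
      hf.continuousAt).continuousWithinAt

/-- As `f` is bounded near the origin, `∫₀^r f s^γ ds = O(r^{γ+1})`. -/
theorem tendsto_moment_div_rpow (hf : Continuous f) (hγ : 0 < γ) :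
    Tendsto (fun r => moment γ f r / r ^ γ) (𝓝[>] 0) (𝓝 0) := by
  obtain ⟨M, hM⟩ := (isCompact_Icc (a := (0 : ℝ)) (b := 1)).exists_bound_of_continuousOn
    hf.continuousOn
  have h2 : Tendsto (fun r : ℝ => M * r) (𝓝[>] 0) (𝓝 0) := by
    have h3 : ContinuousAt (fun r : ℝ => M * r) 0 := by fun_prop
    simpa using h3.tendsto.mono_left (nhdsWithin_le_nhds (s := Ioi 0))
  refine squeeze_zero_norm' ?_ h2
  filter_upwards [Ioo_mem_nhdsGT (zero_lt_one' ℝ)] with r hr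
  have hr0 : 0 < r := hr.1
  have hw : 0 < r ^ γ := Real.rpow_pos_of_pos hr0 γ
  rw [norm_div, Real.norm_of_nonneg hw.le, div_le_iff₀ hw]
  have h4 : ‖∫ s in (0 : ℝ)..r, f s * s ^ γ‖ ≤ M * r ^ γ * |r - 0| := by
    refine intervalIntegral.norm_integral_le_of_norm_le_const fun s hs => ?_
    rw [uIoc_of_le hr0.le] at hs
    rw [norm_mul, Real.norm_of_nonneg (Real.rpow_nonneg hs.1.le _)]
    exact mul_le_mul (hM s ⟨hs.1.le, hs.2.trans hr.2.le⟩)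
      (Real.rpow_le_rpow hs.1.le hs.2 hγ.le) (Real.rpow_nonneg hs.1.le _)
      ((norm_nonneg _).trans (hM 0 ⟨le_rfl, zero_le_one⟩))
  rw [sub_zero, abs_of_pos hr0] at h4
  rw [moment]
  linarith

theorem tendsto_tail (hf : Continuous f) (hfi : IntegrableOn (fun r => f r * r) (Ioi 0)) :
    Tendsto (tail f) (𝓝[>] 0) (𝓝 (tail f 0)) := by
  have hc : Continuous fun s : ℝ => f s * s := hf.mul continuous_id
  have h1 : Tendsto (fun x => tail f 0 - ∫ s in (0 : ℝ)..x, f s * s) (𝓝[>] 0)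
      (𝓝 (tail f 0 - 0)) := by
    refine Tendsto.const_sub _ ?_
    have h2 := (hc.integral_hasStrictDerivAt 0 0).hasDerivAt.continuousAt.tendsto
    rw [intervalIntegral.integral_same] at h2
    exact h2.mono_left nhdsWithin_le_nhds
  rw [sub_zero] at h1
  refine h1.congr' ?_
  filter_upwards [self_mem_nhdsWithin] with x hx
  have hx0 : (0 : ℝ) < x := hx
  have := intervalIntegral.integral_interval_add_Ioi' (a := 0) (b := x) (f := fun s => f s * s)
    (μ := volume) (hc.intervalIntegrable 0 x) (hfi.mono_set (Ioi_subset_Ioi hx0.le))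
  simp only [tail]
  linarith

theorem tendsto_rpow_nhdsGT_zero {γ : ℝ} (hγ : 0 < γ) :
    Tendsto (fun r : ℝ => r ^ γ) (𝓝[>] 0) (𝓝 0) := by
  have h4 := (Real.continuousAt_rpow_const (0 : ℝ) γ (Or.inr hγ.le)).tendsto.mono_left
    (nhdsWithin_le_nhds (s := Ioi 0))
  rwa [Real.zero_rpow hγ.ne'] at h4

theorem tendsto_pow_nhdsGT_zero {k : ℕ} (hk : k ≠ 0) :
    Tendsto (fun r : ℝ => r ^ k) (𝓝[>] 0) (𝓝 0) := by
  have h3 : ContinuousAt (fun r : ℝ => r ^ k) 0 := by fun_prop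
  have := h3.tendsto.mono_left (nhdsWithin_le_nhds (s := Ioi 0))
  rwa [zero_pow hk] at this

theorem tendsto_greenDeriv1 (hα : 1 < α) (hf : Continuous f)
    (hfi : IntegrableOn (fun r => f r * r) (Ioi 0)) :
    Tendsto (greenDeriv1 α f) (𝓝[>] 0) (𝓝 0) := by
  have hA := tendsto_moment_div_rpow hf (show 0 < α + 2 by linarith)
  have hB := tendsto_moment_div_rpow hf (show 0 < α by linarith)
  have hC := tendsto_tail hf hfi
  have h1 := tendsto_pow_nhdsGT_zero one_ne_zero
  have h2 := tendsto_pow_nhdsGT_zero two_ne_zero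
  have h := ((((hA.mul h2).div_const (2 * (α + 1))).sub
    ((hB.mul h2).div_const (2 * (α - 1))))).sub ((h1.mul hC).div_const ((α + 1) * (α - 1)))
  simp only [mul_zero, zero_mul, zero_div, sub_zero] at h
  refine h.congr' ?_
  filter_upwards [self_mem_nhdsWithin] with r hr
  have hr0 : (0 : ℝ) < r := hr
  have hw : 0 < r ^ α := Real.rpow_pos_of_pos hr0 α
  rw [rpow_add_two hr0, greenDeriv1]
  field_simp

theorem tendsto_greenDeriv2 (hα : 1 < α) (hf : Continuous f)
    (hfi : IntegrableOn (fun r => f r * r) (Ioi 0)) :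
    Tendsto (greenDeriv2 α f) (𝓝[>] 0) (𝓝 (-(tail f 0 / ((α + 1) * (α - 1))))) := by
  have hA := tendsto_moment_div_rpow hf (show 0 < α + 2 by linarith)
  have hB := tendsto_moment_div_rpow hf (show 0 < α by linarith)
  have hC := tendsto_tail hf hfi
  have h1 := tendsto_pow_nhdsGT_zero one_ne_zero
  have h := ((((hA.mul h1).const_mul (-α)).div_const (2 * (α + 1))).add
    (((hB.mul h1).const_mul (α - 2)).div_const (2 * (α - 1)))).sub
      (hC.div_const ((α + 1) * (α - 1)))
  simp only [mul_zero, zero_div, add_zero, zero_sub] at h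
  refine h.congr' ?_
  filter_upwards [self_mem_nhdsWithin] with r hr
  have hr0 : (0 : ℝ) < r := hr
  have hw : 0 < r ^ α := Real.rpow_pos_of_pos hr0 α
  rw [rpow_add_two hr0, greenDeriv2]
  field_simp

theorem tendsto_greenDeriv3 (hα : 1 < α) (hf : Continuous f) :
    Tendsto (greenDeriv3 α f) (𝓝[>] 0) (𝓝 0) := by
  have hA := tendsto_moment_div_rpow hf (show 0 < α + 2 by linarith)
  have hB := tendsto_moment_div_rpow hf (show 0 < α by linarith)
  have h := (hA.const_mul (α / 2)).add (hB.const_mul ((2 - α) / 2))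
  simp only [mul_zero, add_zero] at h
  refine h.congr' ?_
  filter_upwards [self_mem_nhdsWithin] with r hr
  rw [rpow_add_two hr, greenDeriv3]

theorem tendsto_greenLaplacian (hα : 1 < α) (hf : Continuous f)
    (hfi : IntegrableOn (fun r => f r * r) (Ioi 0)) :
    Tendsto (greenLaplacian α f) (𝓝[>] 0) (𝓝 (-tail f 0 / (α - 1))) := by
  have hB := tendsto_moment_div_rpow hf (show 0 < α by linarith)
  have h1 := tendsto_pow_nhdsGT_zero one_ne_zero
  have h := ((hB.mul h1).add (tendsto_tail hf hfi)).neg.div_const (α - 1)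
  simp only [mul_zero, zero_add] at h
  refine h.congr' ?_
  filter_upwards [self_mem_nhdsWithin] with r hr
  rw [greenLaplacian]
  ring

end

theorem eqOn_iteratedDeriv {f : ℕ → ℝ → ℝ} {u : ℝ → ℝ} {s : Set ℝ} (hs : IsOpen s)
    (h0 : EqOn u (f 0) s) (n : ℕ) (h : ∀ i < n, ∀ r ∈ s, HasDerivAt (f i) (f (i + 1) r) r) :
    EqOn (iteratedDeriv n u) (f n) s := by
  induction n with
  | zero => simpa using h0
  | succ n ih =>
    intro r hr
    have h1 := ih fun i hi => h i (hi.trans n.lt_succ_self)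
    rw [iteratedDeriv_succ, (h1.eventuallyEq_of_mem (hs.mem_nhds hr)).deriv_eq]
    exact (h n n.lt_succ_self r hr).deriv

theorem contDiffOn_of_hasDerivAt {s : Set ℝ} (hs : IsOpen s) (n : ℕ) :
    ∀ {f : ℕ → ℝ → ℝ}, (∀ i < n, ∀ r ∈ s, HasDerivAt (f i) (f (i + 1) r) r) →
      ContinuousOn (f n) s → ContDiffOn ℝ n (f 0) s := by
  induction n with
  | zero => intro f _ hc; simpa using hc
  | succ n ih =>
    intro f h hc
    rw [Nat.cast_succ, contDiffOn_succ_iff_deriv_of_isOpen hs]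
    refine ⟨fun r hr => (h 0 n.succ_pos r hr).differentiableAt.differentiableWithinAt,
      fun h => absurd h (by simp), ?_⟩
    refine (ih (f := fun i => f (i + 1)) (fun i hi r hr => h (i + 1) (by omega) r hr) hc).congr ?_
    exact fun r hr => (h 0 n.succ_pos r hr).deriv

/-- The representation of weak solutions: testing the weak form of `Δ_α² u = f` with
`ballPotential α r` gives `u'(r)` as an integral of `f` against the Green kernel. -/
theorem deriv_eq_greenDeriv1 {α : ℝ} (hα : 3 < α) {u f : ℝ → ℝ} (hu : u ∈ space α)
    (hf : Continuous f) (hfi : IntegrableOn (fun r => f r * r) (Ioi 0))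
    (hweak : ∀ v ∈ space α, ∫ r in Ioi (0 : ℝ), laplacian α u r * laplacian α v r * r ^ α =
      ∫ r in Ioi (0 : ℝ), f r * v r * r ^ α) {b : ℝ} (hb : 0 < b) :
    deriv u b = greenDeriv1 α f b := by
  have hα1 : 1 < α := by linarith
  have h1 := hweak _ (ballPotential_mem_space hα hb)
  rw [integral_laplacian_mul_ballPotential hα hu hb] at h1
  have hw : 0 < b ^ α := Real.rpow_pos_of_pos hb α
  have hA : IntegrableOn (fun s => f s * s ^ (α + 2)) (Ioc 0 b) :=
    ((hf.mul (Real.continuous_rpow_const (by linarith))).intervalIntegrable 0 b).1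
  have hB : IntegrableOn (fun s => f s * s ^ α) (Ioc 0 b) :=
    ((hf.mul (Real.continuous_rpow_const (by linarith))).intervalIntegrable 0 b).1
  have hC := hfi.mono_set (Ioi_subset_Ioi hb.le)
  have e1 : EqOn (fun r => f r * ballPotential α b r * r ^ α)
      (fun r => 1 / (2 * (α + 1)) * (f r * r ^ (α + 2)) -
        b ^ 2 / (2 * (α - 1)) * (f r * r ^ α)) (Ioc 0 b) := by
    intro r hr
    simp only [ballPotential_of_le hα1 hb hr.2, rpow_add_two hr.1]
    ring
  have e2 : EqOn (fun r => f r * ballPotential α b r * r ^ α)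
      (fun r => -(b ^ (α + 1) / ((α + 1) * (α - 1))) * (f r * r)) (Ioi b) := by
    intro r hr
    have hr0 : 0 < r := hb.trans hr
    have e : r ^ (1 - α) * r ^ α = r := by
      rw [← Real.rpow_add hr0]; simp
    simp only [ballPotential_of_ge (le_of_lt hr)]
    linear_combination (-(b ^ (α + 1) / ((α + 1) * (α - 1)) * f r)) * e
  have i1 : IntegrableOn (fun r => f r * ballPotential α b r * r ^ α) (Ioc 0 b) :=
    IntegrableOn.congr_fun ((hA.const_mul _).sub (hB.const_mul _)) e1.symm measurableSet_Ioc
  have i2 : IntegrableOn (fun r => f r * ballPotential α b r * r ^ α) (Ioi b) :=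
    IntegrableOn.congr_fun (hC.const_mul _) e2.symm measurableSet_Ioi
  rw [← Ioc_union_Ioi_eq_Ioi hb.le, setIntegral_union (Ioc_disjoint_Ioi le_rfl) measurableSet_Ioi
    i1 i2, setIntegral_congr_fun measurableSet_Ioc e1, setIntegral_congr_fun measurableSet_Ioi e2,
    integral_sub (hA.const_mul _) (hB.const_mul _), integral_const_mul, integral_const_mul,
    integral_const_mul, ← intervalIntegral.integral_of_le hb.le,
    ← intervalIntegral.integral_of_le hb.le, Real.rpow_add_one hb.ne'] at h1
  rw [greenDeriv1, moment, moment, tail]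
  have h3 : α - 1 ≠ 0 := by linarith
  have h2 : α + 1 ≠ 0 := by linarith
  field_simp at h1 ⊢
  linear_combination h1

/-- Regularity of weak solutions of `Δ_α² u = f` with a right-hand side continuous up to `0`. -/
theorem nonsingular_three_of_weak {α : ℝ} (hα : 3 < α) {u f : ℝ → ℝ} (hu : u ∈ space α)
    (hf : Continuous f) (hfi : IntegrableOn (fun r => f r * r) (Ioi 0))
    (hweak : ∀ v ∈ space α, ∫ r in Ioi (0 : ℝ), laplacian α u r * laplacian α v r * r ^ α =
      ∫ r in Ioi (0 : ℝ), f r * v r * r ^ α) {c : ℝ} (hc : Tendsto u (𝓝[>] 0) (𝓝 c)) :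
    Nonsingular 3 u ∧ Tendsto (iteratedDeriv 1 u) (𝓝[>] 0) (𝓝 0) ∧
      Tendsto (iteratedDeriv 3 u) (𝓝[>] 0) (𝓝 0) := by
  have hα1 : 1 < α := by linarith
  let D : ℕ → ℝ → ℝ := fun i => match i with
    | 0 => u
    | 1 => greenDeriv1 α f
    | 2 => greenDeriv2 α f
    | 3 => greenDeriv3 α f
    | _ => greenDeriv4 α f
  have hD : ∀ i < 4, ∀ r ∈ Ioi (0 : ℝ), HasDerivAt (D i) (D (i + 1) r) r := by
    intro i hi r hr
    have hr0 : 0 < r := hr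
    interval_cases i
    · rw [show D (0 + 1) = greenDeriv1 α f from rfl,
        ← deriv_eq_greenDeriv1 hα hu hf hfi hweak hr0]
      exact (hu.1 r hr0).hasDerivAt
    · exact hasDerivAt_greenDeriv1 hα1 hf hfi hr0
    · exact hasDerivAt_greenDeriv2 hα1 hf hfi hr0
    · exact hasDerivAt_greenDeriv3 hα1 hf hr0
  have hlim : ∀ i ≤ 3, ∀ l, Tendsto (D i) (𝓝[>] 0) (𝓝 l) →
      Tendsto (iteratedDeriv i u) (𝓝[>] 0) (𝓝 l) := by
    intro i hi l h
    refine h.congr' ?_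
    filter_upwards [self_mem_nhdsWithin] with r hr
    exact (eqOn_iteratedDeriv (f := D) isOpen_Ioi (fun _ _ => rfl) i
      (fun j hj => hD j (by omega)) hr).symm
  have h1 := hlim 1 (by norm_num) 0 (tendsto_greenDeriv1 hα1 hf hfi)
  have h3 := hlim 3 le_rfl 0 (tendsto_greenDeriv3 hα1 hf)
  refine ⟨⟨contDiffOn_of_hasDerivAt (f := D) isOpen_Ioi 4 hD
    (continuousOn_greenDeriv4 hα1 hf), fun i hi => ?_⟩, h1, h3⟩
  interval_cases i
  · exact ⟨c, hlim 0 (by norm_num) c hc⟩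
  · exact ⟨0, h1⟩
  · exact ⟨_, hlim 2 (by norm_num) _ (tendsto_greenDeriv2 hα1 hf hfi)⟩
  · exact ⟨0, h3⟩

/-! ### Comparison and uniqueness for the first-order system -/

/-- The equation `Δ_α² u = g` on `(0, ∞)` with data regular at the origin, as a first-order system:
`q = r^α u'`, `w = Δ_α u`, `p = r^α w'`; the values `c`, `e` of `u`, `Δ_α u` at `0⁺` are recorded,
and the fluxes `q`, `p` vanish there. -/
structure RadialSystem (α : ℝ) (u q w p g : ℝ → ℝ) (c e : ℝ) : Prop where
  deriv_u : ∀ r, 0 < r → HasDerivAt u (q r / r ^ α) r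
  deriv_q : ∀ r, 0 < r → HasDerivAt q (r ^ α * w r) r
  deriv_w : ∀ r, 0 < r → HasDerivAt w (p r / r ^ α) r
  deriv_p : ∀ r, 0 < r → HasDerivAt p (r ^ α * g r) r
  tendsto_u : Tendsto u (𝓝[>] 0) (𝓝 c)
  tendsto_q : Tendsto q (𝓝[>] 0) (𝓝 0)
  tendsto_w : Tendsto w (𝓝[>] 0) (𝓝 e)
  tendsto_p : Tendsto p (𝓝[>] 0) (𝓝 0)

section

variable {α c e : ℝ} {u q w p g : ℝ → ℝ}

theorem RadialSystem.sub {c' e' : ℝ} {u' q' w' p' g' : ℝ → ℝ}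
    (h : RadialSystem α u q w p g c e) (h' : RadialSystem α u' q' w' p' g' c' e') :
    RadialSystem α (fun r => u r - u' r) (fun r => q r - q' r) (fun r => w r - w' r)
      (fun r => p r - p' r) (fun r => g r - g' r) (c - c') (e - e') where
  deriv_u r hr := ((h.deriv_u r hr).fun_sub (h'.deriv_u r hr)).congr_deriv (by ring)
  deriv_q r hr := ((h.deriv_q r hr).fun_sub (h'.deriv_q r hr)).congr_deriv (by ring)
  deriv_w r hr := ((h.deriv_w r hr).fun_sub (h'.deriv_w r hr)).congr_deriv (by ring)
  deriv_p r hr := ((h.deriv_p r hr).fun_sub (h'.deriv_p r hr)).congr_deriv (by ring)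
  tendsto_u := h.tendsto_u.sub h'.tendsto_u
  tendsto_q := by simpa using h.tendsto_q.sub h'.tendsto_q
  tendsto_w := h.tendsto_w.sub h'.tendsto_w
  tendsto_p := by simpa using h.tendsto_p.sub h'.tendsto_p

theorem le_of_hasDerivAt_nonneg {h h' : ℝ → ℝ} {l T : ℝ}
    (hd : ∀ r ∈ Ioo 0 T, HasDerivAt h (h' r) r) (h0 : Tendsto h (𝓝[>] 0) (𝓝 l))
    (hn : ∀ r ∈ Ioo 0 T, 0 ≤ h' r) : ∀ r ∈ Ioo 0 T, l ≤ h r := by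
  intro r hr
  have hm : MonotoneOn h (Ioo 0 T) := by
    refine monotoneOn_of_deriv_nonneg (convex_Ioo 0 T)
      (fun x hx => (hd x hx).continuousAt.continuousWithinAt) ?_ ?_ <;> rw [interior_Ioo]
    · exact fun x hx => (hd x hx).differentiableAt.differentiableWithinAt
    · exact fun x hx => (hd x hx).deriv ▸ hn x hx
  refine le_of_tendsto h0 ?_
  filter_upwards [Ioo_mem_nhdsGT hr.1] with x hx
  exact hm ⟨hx.1, hx.2.trans hr.2⟩ hr hx.2.le

theorem abs_le_of_hasDerivAt {h h' k k' : ℝ → ℝ} {T : ℝ}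
    (hd : ∀ r ∈ Ioo 0 T, HasDerivAt h (h' r) r) (h0 : Tendsto h (𝓝[>] 0) (𝓝 0))
    (hk : ∀ r ∈ Ioo 0 T, HasDerivAt k (k' r) r) (k0 : Tendsto k (𝓝[>] 0) (𝓝 0))
    (hn : ∀ r ∈ Ioo 0 T, |h' r| ≤ k' r) : ∀ r ∈ Ioo 0 T, |h r| ≤ k r := by
  intro r hr
  have h1 := le_of_hasDerivAt_nonneg (h := fun x => k x - h x) (h' := fun x => k' x - h' x)
    (l := 0) (fun x hx => (hk x hx).fun_sub (hd x hx)) (by simpa using k0.sub h0)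
    (fun x hx => by have := (abs_le.1 (hn x hx)).2; linarith) r hr
  have h2 := le_of_hasDerivAt_nonneg (h := fun x => k x + h x) (h' := fun x => k' x + h' x)
    (l := 0) (fun x hx => (hk x hx).fun_add (hd x hx)) (by simpa using k0.add h0)
    (fun x hx => by have := (abs_le.1 (hn x hx)).1; linarith) r hr
  exact abs_le.2 ⟨by linarith, by linarith⟩

/-- If `Δ_α u(0) > 0` and `g ≥ 0` on `(0, T)`, then `w = Δ_α u` is nondecreasing there, and
`q = r^α u'` is at least `w(0) r^{α+1} / (α+1)`. -/
theorem RadialSystem.q_pos (hα : 0 < α) (h : RadialSystem α u q w p g c e) (he : 0 < e) {T : ℝ}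
    (hg : ∀ r ∈ Ioo 0 T, 0 ≤ g r) : ∀ r ∈ Ioo 0 T, 0 < q r := by
  have hp := le_of_hasDerivAt_nonneg (fun r hr => h.deriv_p r hr.1) h.tendsto_p
    (fun r (hr : r ∈ Ioo 0 T) => mul_nonneg (Real.rpow_nonneg hr.1.le _) (hg r hr))
  have hw := le_of_hasDerivAt_nonneg (fun r hr => h.deriv_w r hr.1) h.tendsto_w
    (fun r (hr : r ∈ Ioo 0 T) => div_nonneg (hp r hr) (Real.rpow_nonneg hr.1.le _))
  have hd : ∀ r ∈ Ioo 0 T, HasDerivAt (fun x => q x - e / (α + 1) * x ^ (α + 1))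
      (r ^ α * w r - e * r ^ α) r := by
    intro r hr
    refine ((h.deriv_q r hr.1).fun_sub ((Real.hasDerivAt_rpow_const (p := α + 1)
      (Or.inl hr.1.ne')).const_mul (e / (α + 1)))).congr_deriv ?_
    rw [add_sub_cancel_right]
    field_simp
  have hlim : Tendsto (fun x : ℝ => q x - e / (α + 1) * x ^ (α + 1)) (𝓝[>] 0) (𝓝 0) := by
    have h3 : ContinuousAt (fun x : ℝ => e / (α + 1) * x ^ (α + 1)) 0 :=
      continuousAt_const.mul (Real.continuousAt_rpow_const _ _ (Or.inr (by linarith)))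
    have h4 := h3.tendsto.mono_left (nhdsWithin_le_nhds (s := Ioi 0))
    rw [Real.zero_rpow (by linarith), mul_zero] at h4
    simpa using h.tendsto_q.sub h4
  intro r hr
  have h1 := le_of_hasDerivAt_nonneg hd hlim (fun r hr => by
    have h2 := mul_nonneg (Real.rpow_nonneg hr.1.le α) (sub_nonneg.2 (hw r hr))
    linarith) r hr
  have h5 : 0 < e / (α + 1) * r ^ (α + 1) := by
    have := Real.rpow_pos_of_pos hr.1 (α + 1)
    positivity
  linarith

/-- A solution of `Δ_α² u = g` with `u(0) = 0` and `Δ_α u(0) > 0`, where `g ≥ 0` wherever `u ≥ 0`,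
increases on all of `(0, ∞)`: as long as `u ≥ 0`, `Δ_α u` stays above its value at the origin, which
in turn makes `u` increase. In particular `u` does not decay at infinity. -/
theorem RadialSystem.not_tendsto_zero (hα : 0 < α) (h : RadialSystem α u q w p g 0 e) (he : 0 < e)
    (hg : ∀ r, 0 < r → 0 ≤ u r → 0 ≤ g r) : ¬ Tendsto u atTop (𝓝 0) := by
  have hmono : ∀ T, (∀ r ∈ Ioo 0 T, 0 < q r) → StrictMonoOn u (Ioo 0 T) := by
    intro T hT
    refine strictMonoOn_of_deriv_pos (convex_Ioo 0 T)
      (fun x hx => (h.deriv_u x hx.1).continuousAt.continuousWithinAt) ?_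
    rw [interior_Ioo]
    intro x hx
    rw [(h.deriv_u x hx.1).deriv]
    exact div_pos (hT x hx) (Real.rpow_pos_of_pos hx.1 _)
  have hpos : ∀ T, (∀ r ∈ Ioo 0 T, 0 ≤ u r) → StrictMonoOn u (Ioo 0 T) := fun T hT =>
    hmono T (h.q_pos hα he fun r hr => hg r hr.1 (hT r hr))
  -- near the origin `Δ_α u > 0`, hence `u ≥ 0`
  obtain ⟨δ, hδ, hδ'⟩ : ∃ δ > 0, ∀ r ∈ Ioo 0 δ, 0 ≤ u r := by
    have h1 := h.tendsto_w.eventually (eventually_gt_nhds he)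
    obtain ⟨δ, hδ, h2⟩ := mem_nhdsGT_iff_exists_Ioo_subset.1 h1
    have hq := le_of_hasDerivAt_nonneg (fun r hr => h.deriv_q r hr.1) h.tendsto_q
      (fun r (hr : r ∈ Ioo 0 δ) => mul_nonneg (Real.rpow_nonneg hr.1.le _) (le_of_lt (h2 hr)))
    exact ⟨δ, hδ, le_of_hasDerivAt_nonneg (fun r hr => h.deriv_u r hr.1) h.tendsto_u
      (fun r (hr : r ∈ Ioo 0 δ) => div_nonneg (hq r hr) (Real.rpow_nonneg hr.1.le _))⟩
  -- `u` stays nonnegative: at the infimum `T` of the points where `u < 0` it would be positive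
  have hnn : ∀ r, 0 < r → 0 ≤ u r := by
    by_contra! hcon
    set B : Set ℝ := {r | 0 < r ∧ u r < 0} with hB
    have hBne : B.Nonempty := hcon
    have hBδ : ∀ r ∈ B, δ ≤ r := fun r hr => by
      by_contra! hlt
      exact absurd (hδ' r ⟨hr.1, hlt⟩) (not_le.2 hr.2)
    have hBb : BddBelow B := ⟨δ, hBδ⟩
    set T := sInf B with hT
    have hT0 : 0 < T := hδ.trans_le (le_csInf hBne hBδ)
    have hlt : ∀ r ∈ Ioo 0 T, 0 ≤ u r := fun r hr => by
      by_contra! hneg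
      exact absurd (csInf_le hBb (show r ∈ B from ⟨hr.1, hneg⟩)) (not_le.2 hr.2)
    have hm := hpos T hlt
    have hhalf : 0 < u (T / 2) :=
      (hlt (T / 4) ⟨by linarith, by linarith⟩).trans_lt
        (hm ⟨by linarith, by linarith⟩ ⟨by linarith, by linarith⟩ (by linarith))
    have hcT := (h.deriv_u T hT0).continuousAt
    have hTge : u (T / 2) ≤ u T := by
      refine ge_of_tendsto (hcT.tendsto.mono_left (nhdsWithin_le_nhds (s := Iio T))) ?_
      filter_upwards [Ioo_mem_nhdsLT (show T / 2 < T by linarith)] with x hx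
      exact (hm ⟨by linarith, by linarith⟩ ⟨by linarith [hx.1], hx.2⟩ hx.1).le
    have hev := hcT.eventually (eventually_gt_nhds (hhalf.trans_le hTge))
    obtain ⟨η, hη, hball⟩ := Metric.eventually_nhds_iff.1 hev
    obtain ⟨r, hrB, hr⟩ := exists_lt_of_csInf_lt hBne (show sInf B < T + η by linarith)
    have hrT : T ≤ r := csInf_le hBb hrB
    have := hball (y := r) (by rw [Real.dist_eq, abs_of_nonneg (by linarith)]; linarith)
    exact absurd hrB.2 (not_lt.2 this.le)
  intro hlim
  have h1 : 0 < u 1 := (hnn (1 / 2) (by norm_num)).trans_lt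
    (hpos 2 (fun r hr => hnn r hr.1) ⟨by norm_num, by norm_num⟩ ⟨by norm_num, by norm_num⟩
      (by norm_num))
  have h2 : u 1 ≤ 0 := by
    refine ge_of_tendsto hlim ?_
    filter_upwards [eventually_gt_atTop 1] with x hx
    exact (hpos (x + 1) (fun r hr => hnn r hr.1) ⟨by norm_num, by linarith⟩
      ⟨by linarith, by linarith⟩ hx).le
  linarith

/-- The extension of a function on `(0, ∞)` to the whole line by the constant `c` on `(-∞, 0]`. -/
noncomputable def extendConst (u : ℝ → ℝ) (c r : ℝ) : ℝ := if 0 < r then u r else c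

theorem extendConst_of_pos {r : ℝ} (hr : 0 < r) : extendConst u c r = u r := if_pos hr

theorem continuous_extendConst (hu : ContinuousOn u (Ioi 0)) (hc : Tendsto u (𝓝[>] 0) (𝓝 c)) :
    Continuous (extendConst u c) := by
  rw [continuous_iff_continuousAt]
  intro r
  rcases lt_trichotomy r 0 with h | h | h
  · refine (continuousAt_const (y := c)).congr ?_
    filter_upwards [Iio_mem_nhds h] with x hx
    exact (if_neg (not_lt.2 (le_of_lt hx))).symm
  · subst h
    rw [continuousAt_iff_continuous_left'_right']
    have h0 : extendConst u c 0 = c := if_neg (lt_irrefl _)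
    constructor
    · refine (continuousWithinAt_const (b := c)).congr (fun x hx => ?_) h0
      exact if_neg (not_lt.2 (le_of_lt hx))
    · rw [ContinuousWithinAt, h0]
      refine hc.congr' ?_
      filter_upwards [self_mem_nhdsWithin] with x hx using (extendConst_of_pos hx).symm
  · refine (hu.continuousAt (Ioi_mem_nhds h)).congr ?_
    filter_upwards [Ioi_mem_nhds h] with x hx using (extendConst_of_pos hx).symm

/-- Uniqueness for the initial value problem at the singular point `0`, by Grönwall's argument for
`∫₀^r |u|`. -/
theorem RadialSystem.eq_zero (hα : 0 < α) (h : RadialSystem α u q w p g 0 0)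
    (hg : ∀ R, ∃ L, 0 ≤ L ∧ ∀ r ∈ Ioo 0 R, |g r| ≤ L * |u r|) : ∀ r, 0 < r → u r = 0 := by
  intro r₀ hr₀
  set R := r₀ + 1 with hR
  obtain ⟨L, hL0, hL⟩ := hg R
  have hcu : ContinuousOn u (Ioi 0) := fun r hr =>
    (h.deriv_u r hr).continuousAt.continuousWithinAt
  have hce : Continuous fun r => |extendConst u 0 r| :=
    (continuous_extendConst hcu h.tendsto_u).abs
  set D : ℝ → ℝ := fun r => ∫ s in (0 : ℝ)..r, |extendConst u 0 s| with hD
  have hDd : ∀ r, 0 < r → HasDerivAt D |u r| r := fun r hr => by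
    have := (hce.integral_hasStrictDerivAt 0 r).hasDerivAt
    rwa [extendConst_of_pos hr] at this
  have hD0 : Tendsto D (𝓝[>] 0) (𝓝 0) := by
    have h2 := (hce.integral_hasStrictDerivAt 0 0).hasDerivAt.continuousAt.tendsto
    rw [intervalIntegral.integral_same] at h2
    exact h2.mono_left nhdsWithin_le_nhds
  have hDnn : ∀ r, 0 < r → 0 ≤ D r := fun r hr =>
    intervalIntegral.integral_nonneg hr.le fun s _ => abs_nonneg _
  have hid : ∀ k : ℕ, k ≠ 0 → Tendsto (fun r : ℝ => r ^ k) (𝓝[>] 0) (𝓝 0) := fun k hk =>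
    tendsto_pow_nhdsGT_zero hk
  have hrp : Tendsto (fun r : ℝ => r ^ α) (𝓝[>] 0) (𝓝 0) := tendsto_rpow_nhdsGT_zero hα
  -- the barriers dominate `p`, `w`, `q` and `u` in turn, each using the previous bound
  have hp := abs_le_of_hasDerivAt (T := R) (fun r hr => h.deriv_p r hr.1) h.tendsto_p
    (k := fun r => L * (r ^ α * D r))
    (fun r hr => ((hasDerivAt_rpow_div hr.1).fun_mul (hDd r hr.1)).const_mul L)
    (by simpa using (hrp.mul hD0).const_mul L) (fun r hr => by
      have hw : 0 ≤ r ^ α := Real.rpow_nonneg hr.1.le _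
      have h1 : 0 ≤ L * (α * r ^ α / r * D r) := by
        have := hDnn r hr.1
        have := hr.1
        positivity
      rw [abs_mul, abs_of_nonneg hw]
      nlinarith [mul_le_mul_of_nonneg_left (hL r hr) hw])
  have hw := abs_le_of_hasDerivAt (T := R) (fun r hr => h.deriv_w r hr.1) h.tendsto_w
    (k := fun r => L * (r ^ 1 * D r))
    (fun r hr => (((hasDerivAt_id' r).fun_pow 1).fun_mul (hDd r hr.1)).const_mul L)
    (by simpa using ((hid 1 one_ne_zero).mul hD0).const_mul L) (fun r hr => by
      have hw : 0 < r ^ α := Real.rpow_pos_of_pos hr.1 _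
      have h1 : 0 ≤ L * (r * |u r|) := by
        have := hr.1
        positivity
      rw [abs_div, abs_of_pos hw, div_le_iff₀ hw]
      have h2 := hp r hr
      have h3 := mul_nonneg h1 hw.le
      simp only [pow_one, Nat.cast_one, Nat.sub_self, pow_zero]
      nlinarith)
  have hq := abs_le_of_hasDerivAt (T := R) (fun r hr => h.deriv_q r hr.1) h.tendsto_q
    (k := fun r => L * (r ^ α * r ^ 2 * D r))
    (fun r hr => (((hasDerivAt_rpow_div hr.1).fun_mul
      ((hasDerivAt_id' r).fun_pow 2)).fun_mul (hDd r hr.1)).const_mul L)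
    (by simpa using ((hrp.mul (hid 2 two_ne_zero)).mul hD0).const_mul L) (fun r hr => by
      have hr0 : 0 < r := hr.1
      have hW : 0 < r ^ α := Real.rpow_pos_of_pos hr0 _
      have hD1 := hDnn r hr0
      rw [abs_mul, abs_of_pos hW]
      have h2 := mul_le_mul_of_nonneg_left (hw r hr) hW.le
      rw [pow_one] at h2
      have h3 : 0 ≤ L * (α * r ^ α / r * r ^ 2 * D r) := by positivity
      have h4 : 0 ≤ L * (r ^ α * r ^ 2 * |u r|) := by positivity
      have h5 : 0 ≤ L * (r ^ α * r * D r) := by positivity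
      simp only [Nat.cast_ofNat, Nat.reduceSub, pow_one, mul_one]
      linarith)
  have hu := abs_le_of_hasDerivAt (T := R) (fun r hr => h.deriv_u r hr.1) h.tendsto_u
    (k := fun r => L * (r ^ 3 * D r))
    (fun r hr => (((hasDerivAt_id' r).fun_pow 3).fun_mul (hDd r hr.1)).const_mul L)
    (by simpa using (((hid 3 three_ne_zero)).mul hD0).const_mul L) (fun r hr => by
      have hr0 : 0 < r := hr.1
      have hW : 0 < r ^ α := Real.rpow_pos_of_pos hr0 _
      have hD1 := hDnn r hr0
      rw [abs_div, abs_of_pos hW, div_le_iff₀ hW]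
      have h2 := hq r hr
      have h3 : 0 ≤ L * (r ^ 2 * D r) * r ^ α := by positivity
      have h4 : 0 ≤ L * (r ^ 3 * |u r|) * r ^ α := by positivity
      simp only [Nat.cast_ofNat, Nat.reduceSub, mul_one]
      linarith)
  -- Grönwall: `D' = |u| ≤ M D`
  set M := L * R ^ 3 with hM
  have hE := le_of_hasDerivAt_nonneg (T := R) (l := 0) (h := fun r => -(D r * Real.exp (-M * r)))
    (h' := fun r => (M * D r - |u r|) * Real.exp (-M * r))
    (fun r hr => by
      refine ((hDd r hr.1).fun_mul (((hasDerivAt_id' r).const_mul (-M)).exp)).fun_neg.congr_deriv ?_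
      ring)
    (by
      have h1 : Tendsto (fun r : ℝ => Real.exp (-M * r)) (𝓝[>] 0) (𝓝 (Real.exp (-M * 0))) :=
        (Continuous.tendsto (by fun_prop) 0).mono_left nhdsWithin_le_nhds
      simpa using (hD0.mul h1).neg)
    (fun r hr => by
      refine mul_nonneg (sub_nonneg.2 ((hu r hr).trans ?_)) (Real.exp_pos _).le
      have hD1 := hDnn r hr.1
      have h1 : r ^ 3 ≤ R ^ 3 := pow_le_pow_left₀ hr.1.le hr.2.le 3
      calc L * (r ^ 3 * D r) ≤ L * (R ^ 3 * D r) := by gcongr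
        _ = M * D r := by rw [hM]; ring)
  have hmem : r₀ ∈ Ioo 0 R := ⟨hr₀, by linarith⟩
  have h1 := hE r₀ hmem
  have h2 : D r₀ = 0 := by
    refine le_antisymm ?_ (hDnn r₀ hr₀)
    by_contra! hpos
    have := mul_pos hpos (Real.exp_pos (-M * r₀))
    linarith
  have h3 := hu r₀ hmem
  rw [h2, mul_zero, mul_zero] at h3
  exact abs_nonpos_iff.1 h3

/-- Two decaying solutions of `Δ_α² u = F(u)` with the same value at the origin coincide, if `F` is
monotone and locally Lipschitz. -/
theorem RadialSystem.unique (hα : 0 < α) {F : ℝ → ℝ} (hF : Monotone F)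
    (hlip : ∀ M, ∃ L, 0 ≤ L ∧ ∀ x y, |x| ≤ M → |y| ≤ M → |F x - F y| ≤ L * |x - y|)
    {e' : ℝ} {u' q' w' p' : ℝ → ℝ}
    (h : RadialSystem α u q w p (fun r => F (u r)) c e)
    (h' : RadialSystem α u' q' w' p' (fun r => F (u' r)) c e')
    (hu : Tendsto u atTop (𝓝 0)) (hu' : Tendsto u' atTop (𝓝 0)) : ∀ r, 0 < r → u r = u' r := by
  have key : ∀ {e e' : ℝ} {u q w p u' q' w' p' : ℝ → ℝ},
      RadialSystem α u q w p (fun r => F (u r)) c e →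
      RadialSystem α u' q' w' p' (fun r => F (u' r)) c e' →
      Tendsto u atTop (𝓝 0) → Tendsto u' atTop (𝓝 0) → e ≤ e' := by
    intro e e' u q w p u' q' w' p' h h' hu hu'
    by_contra! hlt
    have h1 := h.sub h'
    rw [sub_self] at h1
    refine h1.not_tendsto_zero hα (sub_pos.2 hlt) (fun r _ h2 => ?_) (by simpa using hu.sub hu')
    exact sub_nonneg.2 (hF (sub_nonneg.1 h2))
  -- the initial values of `Δ_α` agree, by the monotonicity argument applied both ways
  have he : e = e' := le_antisymm (key h h' hu hu') (key h' h hu' hu)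
  subst he
  have h1 := h.sub h'
  rw [sub_self, sub_self] at h1
  have hbdd : ∀ {v q w p g : ℝ → ℝ}, RadialSystem α v q w p g c e → ∀ R, ∃ M, ∀ r ∈ Ioo 0 R,
      |v r| ≤ M := by
    intro v q w p g hv R
    have hc := continuous_extendConst
      (fun r hr => (hv.deriv_u r hr).continuousAt.continuousWithinAt) hv.tendsto_u
    obtain ⟨M, hM⟩ := (isCompact_Icc (a := (0 : ℝ)) (b := R)).exists_bound_of_continuousOn
      hc.continuousOn
    refine ⟨M, fun r hr => ?_⟩
    have := hM r ⟨hr.1.le, hr.2.le⟩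
    rwa [extendConst_of_pos hr.1] at this
  have h2 := h1.eq_zero hα (fun R => by
    obtain ⟨M, hM⟩ := hbdd h R
    obtain ⟨M', hM'⟩ := hbdd h' R
    obtain ⟨L, hL0, hL⟩ := hlip (max M M')
    exact ⟨L, hL0, fun r hr => hL _ _ ((hM r hr).trans (le_max_left _ _))
      ((hM' r hr).trans (le_max_right _ _))⟩)
  exact fun r hr => sub_eq_zero.1 (h2 r hr)

end

/-! ### The power nonlinearity and the explicit solutions -/

theorem continuous_abs_rpow_mul_self {p : ℝ} (hp : 2 < p) :
    Continuous fun s : ℝ => |s| ^ (p - 2) * s :=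
  (continuous_abs.rpow_const fun _ => Or.inr (by linarith)).mul continuous_id

theorem hasDerivAt_abs_rpow_mul_self {p : ℝ} (hp : 2 < p) (s : ℝ) :
    HasDerivAt (fun s : ℝ => |s| ^ (p - 2) * s) ((p - 1) * |s| ^ (p - 2)) s := by
  refine hasDerivAt_of_hasDerivAt_of_ne' (x := 0)
    (g := fun s : ℝ => (p - 1) * |s| ^ (p - 2)) (fun y hy => ?_)
    (continuous_abs_rpow_mul_self hp).continuousAt ?_ s
  · have hy' : |y| ≠ 0 := abs_ne_zero.2 hy
    refine (((hasDerivAt_abs hy).rpow_const (p := p - 2) (Or.inl hy')).fun_mul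
      (hasDerivAt_id' y)).congr_deriv ?_
    have h1 : (SignType.sign y : ℝ) * y = |y| := sign_mul_self y
    rw [Real.rpow_sub_one hy']
    field_simp
    linear_combination (p - 2) * h1
  · exact ((continuous_const.mul (continuous_abs.rpow_const
      fun _ => Or.inr (by linarith)))).continuousAt

theorem monotone_abs_rpow_mul_self {p : ℝ} (hp : 2 < p) :
    Monotone fun s : ℝ => |s| ^ (p - 2) * s := by
  refine monotone_of_deriv_nonneg
    (fun s => (hasDerivAt_abs_rpow_mul_self hp s).differentiableAt) fun s => ?_
  rw [(hasDerivAt_abs_rpow_mul_self hp s).deriv]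
  have : 0 ≤ p - 1 := by linarith
  positivity

theorem lipschitz_abs_rpow_mul_self {p : ℝ} (hp : 2 < p) (M : ℝ) : ∃ L, 0 ≤ L ∧
    ∀ x y, |x| ≤ M → |y| ≤ M → |(|x| ^ (p - 2) * x) - |y| ^ (p - 2) * y| ≤ L * |x - y| := by
  rcases lt_or_ge M 0 with hM | hM
  · exact ⟨0, le_rfl, fun x y hx _ => absurd ((abs_nonneg x).trans hx) (not_le.2 hM)⟩
  have hp1 : 0 ≤ p - 1 := by linarith
  refine ⟨(p - 1) * M ^ (p - 2), by positivity, fun x y hx hy => ?_⟩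
  refine (convex_Icc (-M) M).norm_image_sub_le_of_norm_hasDerivWithin_le
    (f' := fun s : ℝ => (p - 1) * |s| ^ (p - 2))
    (fun s _ => (hasDerivAt_abs_rpow_mul_self hp s).hasDerivWithinAt) (fun s hs => ?_)
    (abs_le.1 hy) (abs_le.1 hx)
  rw [Real.norm_of_nonneg (by positivity)]
  have h1 : |s| ≤ M := abs_le.2 hs
  have h2 : 0 ≤ p - 2 := by linarith
  gcongr

/-- The profile `(1 + μ r²)^{-β}`. -/
noncomputable def profile (μ β r : ℝ) : ℝ := (1 + μ * r ^ 2) ^ (-β)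

section

variable {α μ : ℝ}

theorem one_add_pos (hμ : 0 ≤ μ) (r : ℝ) : 0 < 1 + μ * r ^ 2 := by positivity

theorem profile_pos (hμ : 0 ≤ μ) (β r : ℝ) : 0 < profile μ β r :=
  Real.rpow_pos_of_pos (one_add_pos hμ r) _

theorem profile_add_one (hμ : 0 ≤ μ) (β r : ℝ) :
    μ * r ^ 2 * profile μ (β + 1) r = profile μ β r - profile μ (β + 1) r := by
  have h : profile μ β r = profile μ (β + 1) r * (1 + μ * r ^ 2) := by
    rw [profile, profile, ← Real.rpow_add_one (one_add_pos hμ r).ne']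
    congr 1; ring
  rw [h]; ring

theorem hasDerivAt_profile (hμ : 0 ≤ μ) (β r : ℝ) :
    HasDerivAt (profile μ β) (-2 * β * μ * r * profile μ (β + 1) r) r := by
  have h1 : HasDerivAt (fun x : ℝ => 1 + μ * x ^ 2) (μ * (2 * r)) r := by
    simpa using (((hasDerivAt_id' r).fun_pow 2).const_mul μ).const_add 1
  refine (h1.rpow_const (p := -β) (Or.inl (one_add_pos hμ r).ne')).congr_deriv ?_
  rw [profile, show -β - 1 = -(β + 1) by ring]
  ring

theorem tendsto_profile_zero (hμ : 0 ≤ μ) (β : ℝ) :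
    Tendsto (profile μ β) (𝓝[>] 0) (𝓝 1) := by
  have h := (hasDerivAt_profile hμ β 0).continuousAt.tendsto
  have h0 : profile μ β 0 = 1 := by simp [profile]
  rw [h0] at h
  exact h.mono_left nhdsWithin_le_nhds

theorem tendsto_profile_atTop (hμ : 0 < μ) {β : ℝ} (hβ : 0 < β) :
    Tendsto (profile μ β) atTop (𝓝 0) := by
  have h : Tendsto (fun r : ℝ => 1 + μ * r ^ 2) atTop atTop :=
    tendsto_atTop_add_const_left _ _ ((tendsto_pow_atTop two_ne_zero).const_mul_atTop hμ)
  exact (tendsto_rpow_neg_atTop hβ).comp h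

theorem constP_two (α : ℝ) : constP α 2 = (α - 3) * (α - 1) * (α + 1) * (α + 3) := by
  have : Finset.Ico (-((2 : ℕ) : ℤ)) ((2 : ℕ) : ℤ) = {-2, -1, 0, 1} := by decide
  rw [constP, this]
  simp
  ring

theorem constP_two_pos (hα : 3 < α) : 0 < constP α 2 := by
  rw [constP_two]
  have h1 : 0 < α - 3 := by linarith
  have h2 : 0 < α - 1 := by linarith
  have h3 : 0 < α + 1 := by linarith
  have h4 : 0 < α + 3 := by linarith
  positivity

/-- The functions `c (1 + μ r²)^{-(α-3)/2}` solve
`Δ_α² U = P(α, 2) μ² c (1 + μ r²)^{-(α+5)/2}`. -/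
theorem radialSystem_profile (hα : 3 < α) (hμ : 0 ≤ μ) (c : ℝ) :
    RadialSystem α (fun r => c * profile μ ((α - 3) / 2) r)
      (fun r => -(α - 3) * c * μ * (r ^ α * r * profile μ ((α - 3) / 2 + 1) r))
      (fun r => -(α - 3) * c * μ * (2 * profile μ ((α - 3) / 2 + 1) r +
        (α - 1) * profile μ ((α - 3) / 2 + 1 + 1) r))
      (fun r => (α - 3) * c * μ * (α - 1) * μ * (r ^ α * r *
        (2 * profile μ ((α - 3) / 2 + 1 + 1) r +
          (α + 1) * profile μ ((α - 3) / 2 + 1 + 1 + 1) r)))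
      (fun r => constP α 2 * μ ^ 2 * c * profile μ ((α - 3) / 2 + 1 + 1 + 1 + 1) r)
      c (-(α - 3) * c * μ * (α + 1)) := by
  have hz : Tendsto (fun r : ℝ => r ^ α * r) (𝓝[>] 0) (𝓝 0) := by
    simpa using (tendsto_rpow_nhdsGT_zero (show 0 < α by linarith)).mul
      (tendsto_pow_nhdsGT_zero one_ne_zero)
  refine ⟨fun r hr => ?_, fun r hr => ?_, fun r hr => ?_, fun r hr => ?_, ?_, ?_, ?_, ?_⟩
  · refine ((hasDerivAt_profile hμ ((α - 3) / 2) r).const_mul c).congr_deriv ?_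
    have hw : r ^ α ≠ 0 := (Real.rpow_pos_of_pos hr α).ne'
    field_simp
  · refine ((((hasDerivAt_rpow_div hr).fun_mul (hasDerivAt_id' r)).fun_mul
      (hasDerivAt_profile hμ ((α - 3) / 2 + 1) r)).const_mul _).congr_deriv ?_
    have h1 := profile_add_one hμ ((α - 3) / 2 + 1) r
    generalize profile μ ((α - 3) / 2 + 1 + 1) r = Y at *
    generalize profile μ ((α - 3) / 2 + 1) r = X at *
    field_simp
    linear_combination (-c * μ * (α - 3) * (-(α - 1))) * h1
  · refine ((((hasDerivAt_profile hμ ((α - 3) / 2 + 1) r).const_mul 2).fun_add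
      ((hasDerivAt_profile hμ ((α - 3) / 2 + 1 + 1) r).const_mul (α - 1))).const_mul _).congr_deriv
        ?_
    have hw : r ^ α ≠ 0 := (Real.rpow_pos_of_pos hr α).ne'
    field_simp
    ring
  · refine ((((hasDerivAt_rpow_div hr).fun_mul (hasDerivAt_id' r)).fun_mul
      (((hasDerivAt_profile hμ ((α - 3) / 2 + 1 + 1) r).const_mul 2).fun_add
      ((hasDerivAt_profile hμ ((α - 3) / 2 + 1 + 1 + 1) r).const_mul
        (α + 1)))).const_mul _).congr_deriv ?_
    have h1 := profile_add_one hμ ((α - 3) / 2 + 1 + 1) r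
    have h2 := profile_add_one hμ ((α - 3) / 2 + 1 + 1 + 1) r
    rw [constP_two]
    generalize profile μ ((α - 3) / 2 + 1 + 1 + 1 + 1) r = Z at *
    generalize profile μ ((α - 3) / 2 + 1 + 1 + 1) r = Y at *
    generalize profile μ ((α - 3) / 2 + 1 + 1) r = X at *
    field_simp
    linear_combination (c * μ ^ 2 * (α - 3) * (α - 1) * (α + 1) * (-2)) * h1 +
      (c * μ ^ 2 * (α - 3) * (α - 1) * (α + 1) * (-(α + 3))) * h2
  · simpa using (tendsto_profile_zero hμ ((α - 3) / 2)).const_mul c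
  · simpa using (hz.mul (tendsto_profile_zero hμ ((α - 3) / 2 + 1))).const_mul
      (-(α - 3) * c * μ)
  · have h := (((tendsto_profile_zero hμ ((α - 3) / 2 + 1)).const_mul 2).add
      ((tendsto_profile_zero hμ ((α - 3) / 2 + 1 + 1)).const_mul (α - 1))).const_mul
        (-(α - 3) * c * μ)
    convert h using 2
    ring
  · have h := (hz.mul (((tendsto_profile_zero hμ ((α - 3) / 2 + 1 + 1)).const_mul 2).add
      ((tendsto_profile_zero hμ ((α - 3) / 2 + 1 + 1 + 1)).const_mul (α + 1)))).const_mul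
        ((α - 3) * c * μ * (α - 1) * μ)
    simpa using h

/-- The profiles solve the Euler-Lagrange equation once `P(α, 2) μ² = κ |c|^{2*-2}`. -/
theorem constP_mul_profile (hα : 3 < α) (hμ : 0 ≤ μ) {c κ : ℝ}
    (h : constP α 2 * μ ^ 2 = κ * |c| ^ (critExp α - 2)) (r : ℝ) :
    constP α 2 * μ ^ 2 * c * profile μ ((α - 3) / 2 + 1 + 1 + 1 + 1) r =
      κ * (|c * profile μ ((α - 3) / 2) r| ^ (critExp α - 2) *
        (c * profile μ ((α - 3) / 2) r)) := by
  have hy := one_add_pos hμ r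
  have h1 : profile μ ((α - 3) / 2) r ^ (critExp α - 2) * profile μ ((α - 3) / 2) r =
      profile μ ((α - 3) / 2 + 1 + 1 + 1 + 1) r := by
    rw [profile, profile, ← Real.rpow_mul hy.le, ← Real.rpow_add hy, critExp]
    congr 1
    have : α - 3 ≠ 0 := by linarith
    field_simp
    ring
  rw [abs_mul, abs_of_pos (profile_pos hμ _ r), Real.mul_rpow (abs_nonneg _)
    (profile_pos hμ _ r).le, h, ← h1]
  ring

end

/-! ### The variational problem and the Beta integral -/

section

variable {α : ℝ}

theorem weightedNorm_two_sq (α : ℝ) (f : ℝ → ℝ) :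
    weightedNorm α 2 f ^ 2 = ∫ r in Ioi (0 : ℝ), f r ^ 2 * r ^ α := by
  have h1 : ∫ r in Ioi (0 : ℝ), |f r| ^ (2 : ℝ) * r ^ α = ∫ r in Ioi (0 : ℝ), f r ^ 2 * r ^ α := by
    refine setIntegral_congr_fun measurableSet_Ioi fun r _ => ?_
    simp only [Real.rpow_two, sq_abs]
  have h2 : 0 ≤ ∫ r in Ioi (0 : ℝ), f r ^ 2 * r ^ α :=
    setIntegral_nonneg measurableSet_Ioi fun r hr => by
      have : (0 : ℝ) < r := hr
      positivity
  rw [weightedNorm, h1, ← Real.sqrt_eq_rpow, Real.sq_sqrt h2]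

theorem integral_abs_rpow_nonneg (α p : ℝ) (f : ℝ → ℝ) :
    0 ≤ ∫ r in Ioi (0 : ℝ), |f r| ^ p * r ^ α :=
  setIntegral_nonneg measurableSet_Ioi fun r hr => by
    have : (0 : ℝ) < r := hr
    positivity

theorem weightedNorm_nonneg (α p : ℝ) (f : ℝ → ℝ) : 0 ≤ weightedNorm α p f :=
  Real.rpow_nonneg (integral_abs_rpow_nonneg α p f) _

theorem weightedNorm_sq (α p : ℝ) (f : ℝ → ℝ) :
    weightedNorm α p f ^ 2 = (∫ r in Ioi (0 : ℝ), |f r| ^ p * r ^ α) ^ (2 / p) := by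
  rw [weightedNorm, ← Real.rpow_two, ← Real.rpow_mul (integral_abs_rpow_nonneg α p f)]
  congr 1; ring

theorem quotient_nonneg (α : ℝ) (u : ℝ → ℝ) : 0 ≤ quotient α u := by
  rw [quotient]; positivity

theorem sobolevS_nonneg (α : ℝ) : 0 ≤ sobolevS α := by
  refine Real.sInf_nonneg ?_
  rintro q ⟨u, -, -, rfl⟩
  exact quotient_nonneg α u

theorem integral_abs_rpow_critExp_pos (hα : 3 < α) {u : ℝ → ℝ} (hu : u ∈ space α)
    (hn : Nontriv u) : 0 < ∫ r in Ioi (0 : ℝ), |u r| ^ critExp α * r ^ α := by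
  have hp := two_lt_critExp hα
  refine lt_of_le_of_ne (integral_abs_rpow_nonneg α _ u) fun h0 => ?_
  have hnn : 0 ≤ᵐ[volume.restrict (Ioi (0 : ℝ))] fun r => |u r| ^ critExp α * r ^ α := by
    filter_upwards [ae_restrict_mem measurableSet_Ioi] with r hr
    have : (0 : ℝ) < r := hr
    simp only [Pi.zero_apply]
    positivity
  have h1 := (integral_eq_zero_iff_of_nonneg_ae hnn (integrableOn_abs_rpow_critExp hα hu)).1 h0.symm
  have h2 : EqOn (fun r => |u r| ^ critExp α * r ^ α) 0 (Ioi 0) := by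
    refine Measure.eqOn_open_of_ae_eq h1 isOpen_Ioi ?_ continuousOn_const
    exact ((continuousOn_of_mem_space hu).abs.rpow_const fun _ _ => Or.inr (by linarith)).mul
      (continuousOn_rpow_Ioi α)
  obtain ⟨r, hr, hur⟩ := hn
  have h3 := h2 (show r ∈ Ioi 0 from hr)
  have h4 : 0 < |u r| ^ critExp α * r ^ α :=
    mul_pos (Real.rpow_pos_of_pos (abs_pos.2 hur) _) (Real.rpow_pos_of_pos hr _)
  exact h4.ne' h3

/-- The Sobolev inequality with the constant `𝓢`, also for functions vanishing identically. -/
theorem sobolevS_mul_le (hα : 3 < α) {u : ℝ → ℝ} (hu : u ∈ space α) :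
    sobolevS α * (∫ r in Ioi (0 : ℝ), |u r| ^ critExp α * r ^ α) ^ (2 / critExp α) ≤
      ∫ r in Ioi (0 : ℝ), laplacian α u r ^ 2 * r ^ α := by
  have hp := two_lt_critExp hα
  rw [← weightedNorm_two_sq, ← weightedNorm_sq]
  by_cases hn : Nontriv u
  · have h1 : 0 < weightedNorm α (critExp α) u ^ 2 := by
      rw [weightedNorm_sq]
      exact Real.rpow_pos_of_pos (integral_abs_rpow_critExp_pos hα hu hn) _
    rw [← le_div_iff₀ h1]
    refine csInf_le ⟨0, ?_⟩ ⟨u, hu, hn, rfl⟩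
    rintro q ⟨u, -, -, rfl⟩
    exact quotient_nonneg α u
  · have h0 : ∫ r in Ioi (0 : ℝ), |u r| ^ critExp α * r ^ α = 0 := by
      rw [setIntegral_congr_fun (g := fun _ => (0 : ℝ)) measurableSet_Ioi fun r hr => ?_,
        integral_zero]
      have hur : u r = 0 := by
        by_contra hne
        exact hn ⟨r, hr, hne⟩
      simp only [hur, abs_zero, Real.zero_rpow (show critExp α ≠ 0 by linarith), zero_mul]
    rw [weightedNorm_sq, h0, Real.zero_rpow (by positivity), mul_zero]
    positivity

theorem IsMinimizer.sobolevS_mul_eq (hα : 3 < α) {z : ℝ → ℝ} (hz : IsMinimizer α z) :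
    sobolevS α * (∫ r in Ioi (0 : ℝ), |z r| ^ critExp α * r ^ α) ^ (2 / critExp α) =
      ∫ r in Ioi (0 : ℝ), laplacian α z r ^ 2 * r ^ α := by
  have h1 : 0 < weightedNorm α (critExp α) z ^ 2 := by
    rw [weightedNorm_sq]
    exact Real.rpow_pos_of_pos (integral_abs_rpow_critExp_pos hα hz.1 hz.2.1) _
  rw [← weightedNorm_two_sq, ← weightedNorm_sq, ← hz.2.2, quotient, div_mul_cancel₀ _ h1.ne']

theorem add_rpow_le_two_rpow_mul {a b p : ℝ} (ha : 0 ≤ a) (hb : 0 ≤ b) (hp : 0 ≤ p) :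
    (a + b) ^ p ≤ 2 ^ p * (a ^ p + b ^ p) := by
  have key : ∀ {a b : ℝ}, 0 ≤ a → 0 ≤ b → a ≤ b → (a + b) ^ p ≤ 2 ^ p * (a ^ p + b ^ p) := by
    intro a b ha hb hab
    calc (a + b) ^ p ≤ (2 * b) ^ p := Real.rpow_le_rpow (by positivity) (by linarith) hp
      _ = 2 ^ p * b ^ p := Real.mul_rpow zero_le_two hb
      _ ≤ _ := by
        gcongr
        linarith [Real.rpow_nonneg ha p]
  rcases le_total a b with h | h
  · exact key ha hb h
  · rw [add_comm, add_comm (a ^ p)]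
    exact key hb ha h

theorem hasDerivAt_integral_abs_rpow (hα : 3 < α) {z v : ℝ → ℝ} (hz : z ∈ space α)
    (hv : v ∈ space α) :
    HasDerivAt (fun t : ℝ => ∫ r in Ioi (0 : ℝ), |z r + t * v r| ^ critExp α * r ^ α)
      (critExp α * ∫ r in Ioi (0 : ℝ), |z r| ^ (critExp α - 2) * z r * v r * r ^ α) 0 := by
  have hp := two_lt_critExp hα
  set p := critExp α with hpdef
  have hmeas : ∀ t : ℝ, ContinuousOn (fun r => z r + t * v r) (Ioi 0) := fun t =>
    (continuousOn_of_mem_space hz).add (continuousOn_const.mul (continuousOn_of_mem_space hv))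
  have h := hasDerivAt_integral_of_dominated_loc_of_deriv_le
    (μ := volume.restrict (Ioi (0 : ℝ))) (x₀ := (0 : ℝ)) (s := Ioo (-1) 1)
    (F := fun t r => |z r + t * v r| ^ p * r ^ α)
    (F' := fun t r => p * |z r + t * v r| ^ (p - 2) * (z r + t * v r) * v r * r ^ α)
    (bound := fun r => p * 2 ^ p * (|z r| ^ p * r ^ α + |v r| ^ p * r ^ α))
    (Ioo_mem_nhds (by norm_num) (by norm_num)) ?_ ?_ ?_ ?_ ?_ ?_
  · refine h.2.congr_deriv ?_
    rw [← integral_const_mul]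
    refine integral_congr_ae (Eventually.of_forall fun r => ?_)
    simp only [zero_mul, add_zero]
    ring
  · refine Eventually.of_forall fun t => ?_
    exact (((hmeas t).abs.rpow_const fun _ _ => Or.inr (by linarith)).mul
      (continuousOn_rpow_Ioi α)).aestronglyMeasurable measurableSet_Ioi
  · exact (integrableOn_abs_rpow_critExp hα hz).congr
      (Eventually.of_forall fun r => by simp [hpdef])
  · exact ((((continuousOn_const.mul ((hmeas 0).abs.rpow_const fun _ _ =>
      Or.inr (by linarith))).mul (hmeas 0)).mul (continuousOn_of_mem_space hv)).mul
      (continuousOn_rpow_Ioi α)).aestronglyMeasurable measurableSet_Ioi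
  · filter_upwards [ae_restrict_mem measurableSet_Ioi] with r hr t ht
    have hr0 : (0 : ℝ) < r := hr
    have hw : 0 ≤ r ^ α := Real.rpow_nonneg hr0.le _
    have ht1 : |t| ≤ 1 := abs_le.2 ⟨ht.1.le, ht.2.le⟩
    have hm : |z r + t * v r| ≤ |z r| + |v r| := by
      refine (abs_add_le _ _).trans ?_
      rw [abs_mul]
      have := mul_le_mul_of_nonneg_right ht1 (abs_nonneg (v r))
      linarith
    set m := |z r| + |v r| with hmdef
    have hm0 : 0 ≤ m := by positivity
    have hpow : m ^ (p - 2) * m * m = m ^ p := by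
      rw [mul_assoc, ← pow_two, ← Real.rpow_two, ← Real.rpow_add' hm0 (by linarith)]
      congr 1; ring
    rw [norm_mul, norm_mul, norm_mul, norm_mul, Real.norm_of_nonneg hw,
      Real.norm_of_nonneg (show 0 ≤ p by linarith), Real.norm_of_nonneg (by positivity),
      Real.norm_eq_abs, Real.norm_eq_abs]
    calc p * |z r + t * v r| ^ (p - 2) * |z r + t * v r| * |v r| * r ^ α
        ≤ p * m ^ (p - 2) * m * m * r ^ α := by
          have h1 : |v r| ≤ m := by rw [hmdef]; linarith [abs_nonneg (z r)]
          have h2 : |z r + t * v r| ^ (p - 2) ≤ m ^ (p - 2) :=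
            Real.rpow_le_rpow (abs_nonneg _) hm (by linarith)
          gcongr
      _ = p * m ^ p * r ^ α := by rw [← hpow]; ring
      _ ≤ p * (2 ^ p * (|z r| ^ p + |v r| ^ p)) * r ^ α := by
          have := add_rpow_le_two_rpow_mul (abs_nonneg (z r)) (abs_nonneg (v r))
            (show 0 ≤ p by linarith)
          gcongr
      _ = _ := by ring
  · exact ((integrableOn_abs_rpow_critExp hα hz).add
      (integrableOn_abs_rpow_critExp hα hv)).const_mul _
  · refine Eventually.of_forall fun r t _ => ?_
    have h1 : HasDerivAt (fun t : ℝ => z r + t * v r) (v r) t := by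
      simpa using ((hasDerivAt_id' t).mul_const (v r)).const_add (z r)
    exact ((hasDerivAt_abs_rpow (z r + t * v r) (show 1 < p by linarith)).comp t h1).mul_const _

/-- The Euler-Lagrange equation of the variational problem, with its Lagrange multiplier. -/
theorem IsMinimizer.weak (hα : 3 < α) {z : ℝ → ℝ} (hz : IsMinimizer α z) {v : ℝ → ℝ}
    (hv : v ∈ space α) :
    ∫ r in Ioi (0 : ℝ), laplacian α z r * laplacian α v r * r ^ α =
      sobolevS α * (∫ r in Ioi (0 : ℝ), |z r| ^ critExp α * r ^ α) ^ (2 / critExp α - 1) *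
        ∫ r in Ioi (0 : ℝ), |z r| ^ (critExp α - 2) * z r * v r * r ^ α := by
  have hp := two_lt_critExp hα
  set J : ℝ → ℝ := fun t => ∫ r in Ioi (0 : ℝ), |z r + t * v r| ^ critExp α * r ^ α with hJ
  have hJ0 : J 0 = ∫ r in Ioi (0 : ℝ), |z r| ^ critExp α * r ^ α := by simp [hJ]
  have hJpos : 0 < J 0 := hJ0 ▸ integral_abs_rpow_critExp_pos hα hz.1 hz.2.1
  set a := ∫ r in Ioi (0 : ℝ), laplacian α z r ^ 2 * r ^ α with ha
  set b := ∫ r in Ioi (0 : ℝ), laplacian α z r * laplacian α v r * r ^ α with hb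
  set d := ∫ r in Ioi (0 : ℝ), laplacian α v r ^ 2 * r ^ α with hd
  -- the defect `φ` in the Sobolev inequality along `z + t v` is nonnegative and vanishes at `t = 0`
  have hQ : ∀ t : ℝ, ∫ r in Ioi (0 : ℝ), laplacian α (fun x => z x + t * v x) r ^ 2 * r ^ α =
      a + t * (2 * b) + t ^ 2 * d := by
    intro t
    have i1 := integrableOn_laplacian_sq hα hz.1
    have i2 := (integrableOn_laplacian_mul hα hz.1 hv).const_mul (2 * t)
    have i3 := (integrableOn_laplacian_sq hα hv).const_mul (t ^ 2)
    have e : (fun r => laplacian α (fun x => z x + t * v x) r ^ 2 * r ^ α)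
        =ᵐ[volume.restrict (Ioi 0)] fun r => laplacian α z r ^ 2 * r ^ α +
          2 * t * (laplacian α z r * laplacian α v r * r ^ α) +
          t ^ 2 * (laplacian α v r ^ 2 * r ^ α) := by
      filter_upwards [laplacian_add_mul_ae hz.1 hv t] with r hr
      rw [hr]; ring
    have i12 : Integrable (fun r => laplacian α z r ^ 2 * r ^ α +
        2 * t * (laplacian α z r * laplacian α v r * r ^ α)) (volume.restrict (Ioi 0)) := i1.add i2
    rw [integral_congr_ae e, integral_add i12 i3, integral_add i1 i2, integral_const_mul,
      integral_const_mul]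
    ring
  set φ : ℝ → ℝ := fun t => a + t * (2 * b) + t ^ 2 * d - sobolevS α * J t ^ (2 / critExp α) with hφ
  have hφ0 : φ 0 = 0 := by
    have := hz.sobolevS_mul_eq hα
    rw [← hJ0] at this
    simp only [hφ, this]
    ring
  have hmin : IsLocalMin φ 0 := by
    refine Eventually.of_forall fun t => ?_
    rw [hφ0]
    have := sobolevS_mul_le hα (add_mul_mem_space hz.1 hv t)
    rw [hQ t] at this
    exact sub_nonneg.2 this
  have hderiv : HasDerivAt φ (2 * b - sobolevS α * ((critExp α *
      ∫ r in Ioi (0 : ℝ), |z r| ^ (critExp α - 2) * z r * v r * r ^ α) * (2 / critExp α) *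
        J 0 ^ (2 / critExp α - 1))) 0 := by
    have h1 := ((hasDerivAt_integral_abs_rpow hα hz.1 hv).rpow_const (p := 2 / critExp α)
      (Or.inl hJpos.ne')).const_mul (sobolevS α)
    have h2 : HasDerivAt (fun t : ℝ => a + t * (2 * b) + t ^ 2 * d) (2 * b) 0 := by
      refine ((((hasDerivAt_id' (0 : ℝ)).mul_const (2 * b)).const_add a).fun_add
        (((hasDerivAt_id' (0 : ℝ)).fun_pow 2).mul_const d)).congr_deriv ?_
      simp
    exact h2.fun_sub h1
  have h0 := hmin.hasDerivAt_eq_zero hderiv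
  rw [hJ0] at h0
  have hp0 : critExp α ≠ 0 := by linarith
  generalize (∫ r in Ioi (0 : ℝ), |z r| ^ critExp α * r ^ α) ^ (2 / critExp α - 1) = X at *
  field_simp at h0
  linear_combination h0 / 2

/-- The value of the Beta integral, from `Γ(α+1) y^{-(α+1)} = ∫₀^∞ t^α e^{-ty} dt` and Fubini's
theorem. -/
theorem Gamma_mul_integral_profile (hα : 0 < α) {μ : ℝ} (hμ : 0 < μ) :
    Real.Gamma (α + 1) * ∫ r in Ioi (0 : ℝ), profile μ (α + 1) r * r ^ α =
      μ ^ (-((α + 1) / 2)) * (Real.Gamma ((α + 1) / 2) * Real.Gamma ((α + 1) / 2) / 2) := by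
  have hα2 : 0 < (α + 1) / 2 := by linarith
  have h1 : ∀ r : ℝ, Real.Gamma (α + 1) * (profile μ (α + 1) r * r ^ α) =
      ∫ t in Ioi (0 : ℝ), r ^ α * (t ^ α * Real.exp (-((1 + μ * r ^ 2) * t))) := by
    intro r
    have := Real.integral_rpow_mul_exp_neg_mul_Ioi (show 0 < α + 1 by linarith)
      (one_add_pos hμ.le r)
    rw [add_sub_cancel_right] at this
    rw [integral_const_mul, this, profile, one_div, Real.inv_rpow (one_add_pos hμ.le r).le,
      Real.rpow_neg (one_add_pos hμ.le r).le]
    ring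
  have h2 : ∀ t : ℝ, 0 < t →
      ∫ r in Ioi (0 : ℝ), r ^ α * (t ^ α * Real.exp (-((1 + μ * r ^ 2) * t))) =
        μ ^ (-((α + 1) / 2)) * (Real.Gamma ((α + 1) / 2) / 2) *
          (Real.exp (-t) * t ^ ((α + 1) / 2 - 1)) := by
    intro t ht
    have e : ∀ r : ℝ, r ^ α * (t ^ α * Real.exp (-((1 + μ * r ^ 2) * t))) =
        t ^ α * Real.exp (-t) * (r ^ α * Real.exp (-(μ * t) * r ^ (2 : ℝ))) := by
      intro r
      rw [Real.rpow_two, show -((1 + μ * r ^ 2) * t) = -t + -(μ * t) * r ^ 2 by ring, Real.exp_add]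
      ring
    simp_rw [e]
    rw [integral_const_mul, integral_rpow_mul_exp_neg_mul_rpow two_pos (by linarith)
      (mul_pos hμ ht), Real.mul_rpow hμ.le ht.le,
      show t ^ ((α + 1) / 2 - 1) = t ^ α * t ^ (-(α + 1) / 2) by
        rw [← Real.rpow_add ht]; congr 1; ring,
      show -((α + 1) / 2) = -(α + 1) / 2 by ring]
    ring
  have hint : Integrable (Function.uncurry fun r t : ℝ =>
      r ^ α * (t ^ α * Real.exp (-((1 + μ * r ^ 2) * t))))
      ((volume.restrict (Ioi 0)).prod (volume.restrict (Ioi 0))) := by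
    have hmeas : Measurable (Function.uncurry fun r t : ℝ =>
        r ^ α * (t ^ α * Real.exp (-((1 + μ * r ^ 2) * t)))) := by
      simp only [Function.uncurry_def]
      fun_prop
    rw [integrable_prod_iff' hmeas.aestronglyMeasurable]
    constructor
    · filter_upwards [ae_restrict_mem measurableSet_Ioi] with t ht
      have ht0 : (0 : ℝ) < t := ht
      have h3 := (integrableOn_rpow_mul_exp_neg_mul_rpow (p := 2) (s := α) (b := μ * t)
        (by linarith) zero_lt_two (mul_pos hμ ht0)).const_mul (t ^ α * Real.exp (-t))
      refine h3.congr (Eventually.of_forall fun r => ?_)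
      simp only [Function.uncurry_apply_pair]
      rw [Real.rpow_two, show -((1 + μ * r ^ 2) * t) = -t + -(μ * t) * r ^ 2 by ring, Real.exp_add]
      ring
    · have h4 : IntegrableOn (fun t => μ ^ (-((α + 1) / 2)) * (Real.Gamma ((α + 1) / 2) / 2) *
          (Real.exp (-t) * t ^ ((α + 1) / 2 - 1))) (Ioi 0) :=
        (Real.GammaIntegral_convergent hα2).const_mul _
      refine h4.congr_fun (fun t ht => ?_) measurableSet_Ioi
      have ht0 : (0 : ℝ) < t := ht
      simp only [← h2 t ht0]
      refine setIntegral_congr_fun measurableSet_Ioi fun r hr => ?_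
      have hr0 : (0 : ℝ) < r := hr
      simp only [Function.uncurry_apply_pair]
      rw [Real.norm_of_nonneg (by positivity)]
  rw [← integral_const_mul]
  simp_rw [h1]
  rw [integral_integral_swap hint, setIntegral_congr_fun measurableSet_Ioi fun t ht => h2 t ht,
    integral_const_mul, ← Real.Gamma_eq_integral hα2]
  ring

end

/-! ### Classification of solutions and the best constant -/

section

variable {α c κ : ℝ} {u : ℝ → ℝ}

/-- The right-hand side `κ |u|^{2*-2} u`, with `u` continued by the constant `c` to `(-∞, 0]`. -/
noncomputable def source (α κ c : ℝ) (u : ℝ → ℝ) (r : ℝ) : ℝ :=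
  κ * (|extendConst u c r| ^ (critExp α - 2) * extendConst u c r)

theorem source_of_pos {r : ℝ} (hr : 0 < r) :
    source α κ c u r = κ * (|u r| ^ (critExp α - 2) * u r) := by
  rw [source, extendConst_of_pos hr]

theorem continuous_source (hα : 3 < α) (hu : u ∈ space α) (hc : Tendsto u (𝓝[>] 0) (𝓝 c)) :
    Continuous (source α κ c u) :=
  continuous_const.mul ((continuous_abs_rpow_mul_self (two_lt_critExp hα)).comp
    (continuous_extendConst (continuousOn_of_mem_space hu) hc))

theorem integrableOn_source (hα : 3 < α) (hu : u ∈ space α) (hc : Tendsto u (𝓝[>] 0) (𝓝 c)) :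
    IntegrableOn (fun r => source α κ c u r * r) (Ioi 0) := by
  have hp := two_lt_critExp hα
  have hcont : Continuous fun r => source α κ c u r * r :=
    (continuous_source hα hu hc).mul continuous_id
  obtain ⟨K, hK0, hK⟩ := exists_abs_le_rpow hα hu
  rw [← Ioc_union_Ioi_eq_Ioi zero_le_one]
  refine (hcont.intervalIntegrable 0 1).1.union ?_
  have h1 : IntegrableOn (fun r : ℝ => |κ| * K ^ (critExp α - 1) * r ^ (-((α + 3) / 2))) (Ioi 1) :=
    (integrableOn_Ioi_rpow_of_lt (by linarith) one_pos).const_mul _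
  refine Integrable.mono' h1 hcont.aestronglyMeasurable ?_
  filter_upwards [ae_restrict_mem measurableSet_Ioi] with r hr
  have hr0 : (0 : ℝ) < r := one_pos.trans hr
  have e1 : |u r| ^ (critExp α - 2) * |u r| = |u r| ^ (critExp α - 1) := by
    rw [← Real.rpow_add_one' (abs_nonneg _) (by linarith)]
    congr 1; ring
  have e2 : |u r| ^ (critExp α - 1) ≤ K ^ (critExp α - 1) * r ^ (-((α + 5) / 2)) := by
    calc |u r| ^ (critExp α - 1) ≤ (K * r ^ (-((α - 3) / 2))) ^ (critExp α - 1) :=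
          Real.rpow_le_rpow (abs_nonneg _) (hK r hr0) (by linarith)
      _ = K ^ (critExp α - 1) * r ^ (-((α + 5) / 2)) := by
          rw [Real.mul_rpow hK0 (by positivity), ← Real.rpow_mul hr0.le]
          congr 2
          rw [critExp]
          have : α - 3 ≠ 0 := by linarith
          field_simp
          ring
  rw [source_of_pos hr0, norm_mul, norm_mul, norm_mul, Real.norm_of_nonneg hr0.le,
    Real.norm_of_nonneg (by positivity : 0 ≤ |u r| ^ (critExp α - 2)), Real.norm_eq_abs,
    Real.norm_eq_abs, e1]
  calc |κ| * |u r| ^ (critExp α - 1) * r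
      ≤ |κ| * (K ^ (critExp α - 1) * r ^ (-((α + 5) / 2))) * r := by gcongr
    _ = |κ| * K ^ (critExp α - 1) * (r ^ (-((α + 5) / 2)) * r) := by ring
    _ = _ := by
        rw [← Real.rpow_add_one hr0.ne']
        congr 2; ring

theorem weak_source (hw : ∀ v ∈ space α,
    ∫ r in Ioi (0 : ℝ), laplacian α u r * laplacian α v r * r ^ α =
      κ * ∫ r in Ioi (0 : ℝ), |u r| ^ (critExp α - 2) * u r * v r * r ^ α) :
    ∀ v ∈ space α, ∫ r in Ioi (0 : ℝ), laplacian α u r * laplacian α v r * r ^ α =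
      ∫ r in Ioi (0 : ℝ), source α κ c u r * v r * r ^ α := by
  intro v hv
  rw [hw v hv, ← integral_const_mul]
  refine setIntegral_congr_fun measurableSet_Ioi fun r hr => ?_
  simp only [source_of_pos (show 0 < r from hr)]
  ring

/-- A weak solution of `Δ_α² u = κ |u|^{2*-2} u` with a finite limit at the origin solves the
corresponding first-order system classically, with regular data at the origin. -/
theorem radialSystem_of_weak (hα : 3 < α) (hu : u ∈ space α) (hc : Tendsto u (𝓝[>] 0) (𝓝 c))
    (hw : ∀ v ∈ space α,
      ∫ r in Ioi (0 : ℝ), laplacian α u r * laplacian α v r * r ^ α =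
        κ * ∫ r in Ioi (0 : ℝ), |u r| ^ (critExp α - 2) * u r * v r * r ^ α) :
    RadialSystem α u (fun r => r ^ α * greenDeriv1 α (source α κ c u) r)
      (greenLaplacian α (source α κ c u)) (moment α (source α κ c u))
      (fun r => κ * (|u r| ^ (critExp α - 2) * u r)) c (-tail (source α κ c u) 0 / (α - 1)) := by
  have hα1 : 1 < α := by linarith
  have hα0 : 0 < α := by linarith
  have hf := continuous_source (κ := κ) hα hu hc
  have hfi := integrableOn_source (κ := κ) hα hu hc
  have hrp := tendsto_rpow_nhdsGT_zero hα0
  refine ⟨fun r hr => ?_, fun r hr => hasDerivAt_rpow_mul_greenDeriv1 hα1 hf hfi hr,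
    fun r hr => hasDerivAt_greenLaplacian hα1 hf hfi hr, fun r hr => ?_, hc, ?_,
    tendsto_greenLaplacian hα1 hf hfi, ?_⟩
  · rw [mul_div_cancel_left₀ _ (Real.rpow_pos_of_pos hr α).ne',
      ← deriv_eq_greenDeriv1 hα hu hf hfi (weak_source hw) hr]
    exact (hu.1 r hr).hasDerivAt
  · rw [← source_of_pos (c := c) hr, mul_comm]
    exact hasDerivAt_moment hf hα0 r
  · simpa using hrp.mul (tendsto_greenDeriv1 hα1 hf hfi)
  · have h := (hasDerivAt_moment hf hα0 0).continuousAt.tendsto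
    rw [show moment α (source α κ c u) 0 = 0 from intervalIntegral.integral_same] at h
    exact h.mono_left nhdsWithin_le_nhds

/-- Weak solutions of `Δ_α² u = 0` in the space vanish. -/
theorem eq_zero_of_weak_zero (hα : 3 < α) (hu : u ∈ space α)
    (hw : ∀ v ∈ space α, ∫ r in Ioi (0 : ℝ), laplacian α u r * laplacian α v r * r ^ α = 0) :
    ∀ r, 0 < r → u r = 0 := by
  have hd : ∀ r, 0 < r → deriv u r = 0 := by
    intro b hb
    have h1 := hw _ (ballPotential_mem_space hα hb)
    rw [integral_laplacian_mul_ballPotential hα hu hb] at h1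
    exact (mul_eq_zero.1 h1).resolve_left (Real.rpow_pos_of_pos hb α).ne'
  refine eq_zero_of_deriv_deriv_eq_zero hu ?_
  filter_upwards [ae_restrict_mem measurableSet_Ioi] with r hr
  have h1 : deriv u =ᶠ[𝓝 r] fun _ => (0 : ℝ) := by
    filter_upwards [Ioi_mem_nhds hr] with x hx using hd x hx
  rw [h1.deriv_eq, deriv_const, Pi.zero_apply]

/-- Classification: the weak solutions of `Δ_α² u = κ |u|^{2*-2} u`, `κ > 0`, with a finite limit at
the origin are `c (1 + μ r²)^{-(α-3)/2}`. -/
theorem eq_profile_of_weak (hα : 3 < α) (hκ : 0 < κ) (hu : u ∈ space α)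
    (hc : Tendsto u (𝓝[>] 0) (𝓝 c))
    (hw : ∀ v ∈ space α,
      ∫ r in Ioi (0 : ℝ), laplacian α u r * laplacian α v r * r ^ α =
        κ * ∫ r in Ioi (0 : ℝ), |u r| ^ (critExp α - 2) * u r * v r * r ^ α) :
    ∃ μ, 0 ≤ μ ∧ constP α 2 * μ ^ 2 = κ * |c| ^ (critExp α - 2) ∧
      ∀ r, 0 < r → u r = c * profile μ ((α - 3) / 2) r := by
  have hp := two_lt_critExp hα
  have hP := constP_two_pos hα
  -- the dilation parameter for which the profile with value `c` at `0` solves the same equation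
  set μ := Real.sqrt (κ * |c| ^ (critExp α - 2) / constP α 2) with hμdef
  have hμ : 0 ≤ μ := Real.sqrt_nonneg _
  have hμ2 : constP α 2 * μ ^ 2 = κ * |c| ^ (critExp α - 2) := by
    rw [hμdef, Real.sq_sqrt (by positivity)]
    field_simp
  refine ⟨μ, hμ, hμ2, ?_⟩
  have hsys := radialSystem_profile hα hμ c
  simp_rw [constP_mul_profile hα hμ hμ2] at hsys
  refine RadialSystem.unique (by linarith)
    (F := fun s => κ * (|s| ^ (critExp α - 2) * s))
    (fun x y hxy => mul_le_mul_of_nonneg_left (monotone_abs_rpow_mul_self hp hxy) hκ.le) ?_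
    (radialSystem_of_weak hα hu hc hw) hsys hu.2.2.1 ?_
  · intro M
    obtain ⟨L, hL0, hL⟩ := lipschitz_abs_rpow_mul_self hp M
    refine ⟨κ * L, by positivity, fun x y hx hy => ?_⟩
    rw [← mul_sub, abs_mul, abs_of_pos hκ, mul_assoc]
    exact mul_le_mul_of_nonneg_left (hL x y hx hy) hκ.le
  · rcases eq_or_ne c 0 with rfl | hc0
    · simp
    · have hμ0 : 0 < μ := by
        refine Real.sqrt_pos.2 ?_
        have := Real.rpow_pos_of_pos (abs_pos.2 hc0) (critExp α - 2)
        positivity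
      simpa using (tendsto_profile_atTop hμ0 (show 0 < (α - 3) / 2 by linarith)).const_mul c

end

theorem Nonsingular.exists_tendsto {z : ℝ → ℝ} (h : Nonsingular 0 z) :
    ∃ c, Tendsto z (𝓝[>] 0) (𝓝 c) := by
  obtain ⟨c, hc⟩ := h.2 0 le_rfl
  exact ⟨c, by rwa [iteratedDeriv_zero] at hc⟩

/-- The value of the infimum, read off from the minimizer. -/
theorem sobolevS_eq {α : ℝ} (hα : 3 < α) {z : ℝ → ℝ} (hz : IsMinimizer α z)
    (hn : Nonsingular 0 z) :
    sobolevS α = constP α 2 * (Real.Gamma ((α + 1) / 2) * Real.Gamma ((α + 1) / 2) /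
      (2 * Real.Gamma (α + 1))) ^ (4 / (α + 1)) := by
  obtain ⟨c, hc⟩ := hn.exists_tendsto
  have hp := two_lt_critExp hα
  set J := ∫ r in Ioi (0 : ℝ), |z r| ^ critExp α * r ^ α with hJ
  have hJ0 : 0 < J := integral_abs_rpow_critExp_pos hα hz.1 hz.2.1
  set κ := sobolevS α * J ^ (2 / critExp α - 1) with hκ
  have hweak := fun v (hv : v ∈ space α) => hz.weak hα hv
  rw [← hJ, ← hκ] at hweak
  -- `κ = 0` would make `z` a weak solution of `Δ_α² z = 0`
  have hκ0 : 0 < κ := by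
    refine lt_of_le_of_ne (mul_nonneg (sobolevS_nonneg α) (Real.rpow_nonneg hJ0.le _)) fun h0 => ?_
    obtain ⟨r, hr, hzr⟩ := hz.2.1
    refine hzr (eq_zero_of_weak_zero hα hz.1 (fun v hv => ?_) r hr)
    rw [hweak v hv, ← h0, zero_mul]
  obtain ⟨μ, hμ, hμ2, hzeq⟩ := eq_profile_of_weak hα hκ0 hz.1 hc hweak
  have hc0 : c ≠ 0 := by
    rintro rfl
    obtain ⟨r, hr, hzr⟩ := hz.2.1
    exact hzr (by rw [hzeq r hr, zero_mul])
  have hca : 0 < |c| := abs_pos.2 hc0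
  have hP := constP_two_pos hα
  have hμ0 : 0 < μ := by
    refine lt_of_le_of_ne hμ fun h0 => ?_
    rw [← h0] at hμ2
    have := mul_pos hκ0 (Real.rpow_pos_of_pos hca (critExp α - 2))
    rw [← hμ2] at this
    simp at this
  set I := Real.Gamma ((α + 1) / 2) * Real.Gamma ((α + 1) / 2) / (2 * Real.Gamma (α + 1)) with hI
  have hG1 : 0 < Real.Gamma (α + 1) := Real.Gamma_pos_of_pos (by linarith)
  have hG2 : 0 < Real.Gamma ((α + 1) / 2) := Real.Gamma_pos_of_pos (by linarith)
  have hI0 : 0 < I := by positivity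
  have hJval : J = |c| ^ critExp α * (μ ^ (-((α + 1) / 2)) * I) := by
    have h1 : ∫ r in Ioi (0 : ℝ), profile μ (α + 1) r * r ^ α = μ ^ (-((α + 1) / 2)) * I := by
      have := Gamma_mul_integral_profile (show 0 < α by linarith) hμ0
      rw [hI]
      field_simp at this ⊢
      linear_combination this
    rw [hJ, ← h1, ← integral_const_mul]
    refine setIntegral_congr_fun measurableSet_Ioi fun r hr => ?_
    have hpr : |c * profile μ ((α - 3) / 2) r| ^ critExp α =
        |c| ^ critExp α * profile μ (α + 1) r := by
      rw [abs_mul, abs_of_pos (profile_pos hμ _ r), Real.mul_rpow hca.le (profile_pos hμ _ r).le,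
        profile, profile, ← Real.rpow_mul (one_add_pos hμ r).le, critExp]
      congr 2
      have : α - 3 ≠ 0 := by linarith
      field_simp
    simp only [hzeq r hr, hpr]
    ring
  have hexp : 1 - 2 / critExp α = 4 / (α + 1) := by
    rw [critExp]
    have h1 : α - 3 ≠ 0 := by linarith
    have h2 : α + 1 ≠ 0 := by linarith
    field_simp
    ring
  have hS : sobolevS α = κ * J ^ (4 / (α + 1)) := by
    rw [hκ, mul_assoc, ← hexp, ← Real.rpow_add hJ0]
    simp
  have hJpow : J ^ (4 / (α + 1)) = |c| ^ (critExp α - 2) * (μ ^ (-2 : ℝ) * I ^ (4 / (α + 1))) := by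
    rw [hJval, Real.mul_rpow (by positivity) (by positivity),
      Real.mul_rpow (by positivity) hI0.le, ← Real.rpow_mul hca.le, ← Real.rpow_mul hμ]
    have h2 : α + 1 ≠ 0 := by linarith
    congr 2
    · rw [← hexp]
      field_simp
    · congr 1
      field_simp
      norm_num
  have hμ4 : μ ^ (-2 : ℝ) * μ ^ 2 = 1 := by
    rw [← Real.rpow_two, ← Real.rpow_add hμ0]
    simp
  rw [hS, hJpow]
  calc κ * (|c| ^ (critExp α - 2) * (μ ^ (-2 : ℝ) * I ^ (4 / (α + 1))))
      = κ * |c| ^ (critExp α - 2) * μ ^ (-2 : ℝ) * I ^ (4 / (α + 1)) := by ring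
    _ = constP α 2 * (μ ^ (-2 : ℝ) * μ ^ 2) * I ^ (4 / (α + 1)) := by rw [← hμ2]; ring
    _ = _ := by rw [hμ4, mul_one]

theorem rpow_neg_half_sq {x : ℝ} (hx : 0 < x) : (x ^ (-(1 / 2) : ℝ)) ^ 2 = x⁻¹ := by
  rw [← Real.rpow_two, ← Real.rpow_mul hx.le, show -(1 / 2) * (2 : ℝ) = -1 by norm_num,
    Real.rpow_neg_one]

/-- If the infimum is positive and attained, then `𝓢^{-1/2}` is the best embedding constant. -/
theorem isLeast_embeddingConstant {α : ℝ} (hα : 3 < α) (hS : 0 < sobolevS α) {z : ℝ → ℝ}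
    (hz : IsMinimizer α z) :
    IsLeast {C : ℝ | IsEmbeddingConstant α C} (sobolevS α ^ (-(1 / 2) : ℝ)) := by
  have hC0 : 0 < sobolevS α ^ (-(1 / 2) : ℝ) := Real.rpow_pos_of_pos hS _
  constructor
  · intro u hu
    refine ⟨integrableOn_abs_rpow_critExp hα hu, ?_, ?_⟩
    · simpa only [Real.rpow_two, sq_abs] using integrableOn_laplacian_sq hα hu
    · refine le_of_sq_le_sq ?_ (mul_nonneg hC0.le (weightedNorm_nonneg _ _ _))
      have h1 := sobolevS_mul_le hα hu
      rw [← weightedNorm_sq, ← weightedNorm_two_sq] at h1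
      rw [mul_pow, rpow_neg_half_sq hS, inv_mul_eq_div, le_div_iff₀ hS, mul_comm]
      exact h1
  · intro C hC
    have h1 := (hC z hz.1).2.2
    have h2 := hz.sobolevS_mul_eq hα
    have hpos := integral_abs_rpow_critExp_pos hα hz.1 hz.2.1
    have hnz : 0 < weightedNorm α (critExp α) z := Real.rpow_pos_of_pos hpos _
    have hΔ := weightedNorm_nonneg α 2 (laplacian α z)
    rw [← weightedNorm_sq, ← weightedNorm_two_sq] at h2
    have h3 : weightedNorm α (critExp α) z =
        sobolevS α ^ (-(1 / 2) : ℝ) * weightedNorm α 2 (laplacian α z) := by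
      refine (sq_eq_sq₀ hnz.le (mul_nonneg hC0.le hΔ)).1 ?_
      rw [mul_pow, rpow_neg_half_sq hS, ← h2]
      field_simp
    have hΔ0 : 0 < weightedNorm α 2 (laplacian α z) := by
      refine lt_of_le_of_ne hΔ fun h0 => ?_
      rw [← h0, mul_zero] at h3
      exact hnz.ne' h3
    rw [h3] at h1
    exact le_of_mul_le_mul_right h1 hΔ0

end WeightedRadial

theorem mainTheorem5 (α : ℝ) (hα : 3 < α) :
    ((∃ z, WeightedRadial.IsMinimizer α z ∧ WeightedRadial.Nonsingular 0 z) →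
      IsLeast {C : ℝ | WeightedRadial.IsEmbeddingConstant α C}
          (WeightedRadial.sobolevS α ^ (-(1 / 2) : ℝ)) ∧
        WeightedRadial.sobolevS α ^ (-(1 / 2) : ℝ) =
          WeightedRadial.constP α 2 ^ (-(1 / 2) : ℝ) *
            (2 * Real.Gamma (α + 1) /
              (Real.Gamma ((α + 1) / 2) * Real.Gamma ((α + 1) / 2))) ^ (2 / (α + 1))) ∧
    (∀ z, WeightedRadial.IsMinimizer α z → WeightedRadial.Nonsingular 0 z →
      WeightedRadial.Nonsingular 3 z ∧
        Tendsto (iteratedDeriv 1 z) (𝓝[>] 0) (𝓝 0) ∧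
        Tendsto (iteratedDeriv 3 z) (𝓝[>] 0) (𝓝 0)) ∧
    (∀ u, WeightedRadial.IsWeakSolution α u → (∀ r, 0 < r → 0 < u r) →
      (∃ c : ℝ, Tendsto u (𝓝[>] 0) (𝓝 c)) →
      WeightedRadial.Nonsingular 3 u ∧
        Tendsto (iteratedDeriv 1 u) (𝓝[>] 0) (𝓝 0) ∧
        Tendsto (iteratedDeriv 3 u) (𝓝[>] 0) (𝓝 0)) := by
  have hG1 : 0 < Real.Gamma (α + 1) := Real.Gamma_pos_of_pos (by linarith)
  have hG2 : 0 < Real.Gamma ((α + 1) / 2) := Real.Gamma_pos_of_pos (by linarith)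
  refine ⟨?_, ?_, ?_⟩
  · rintro ⟨z, hz, hn⟩
    have hP := WeightedRadial.constP_two_pos hα
    have hS := WeightedRadial.sobolevS_eq hα hz hn
    refine ⟨WeightedRadial.isLeast_embeddingConstant hα (hS ▸ by positivity) hz, ?_⟩
    rw [hS, Real.mul_rpow hP.le (by positivity), ← Real.rpow_mul (by positivity),
      ← inv_div (2 * Real.Gamma (α + 1)), Real.inv_rpow (by positivity),
      ← Real.rpow_neg (by positivity)]
    congr 2
    ring
  · intro z hz hn
    obtain ⟨c, hc⟩ := hn.exists_tendsto
    exact WeightedRadial.nonsingular_three_of_weak hα hz.1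
      (WeightedRadial.continuous_source hα hz.1 hc) (WeightedRadial.integrableOn_source hα hz.1 hc)
      (WeightedRadial.weak_source fun v hv => hz.weak hα hv) hc
  · rintro u ⟨hu, hw⟩ - ⟨c, hc⟩
    exact WeightedRadial.nonsingular_three_of_weak hα hu
      (WeightedRadial.continuous_source hα hu hc) (WeightedRadial.integrableOn_source hα hu hc)
      (WeightedRadial.weak_source (κ := 1) fun v hv => by rw [one_mul]; exact hw v hv) hc
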